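/- Let $N\ge 1$. A lower triangular matrix $H=(h_{k,j})\in\mathbb R^{(N-1)\times(N-1)}$ defines the fixed-step algorithm $$y_{k+1}=y_k-\sum_{j=0}^{k}h_{k+1,j+1}\,(y_j-Ty_j),\qquad k=0,\dots,N-2,$$ for an operator $T$ and a starting point $y_0$. Let $\mathcal H_\star(N-1)$ be the set of all such $H$ for which $$\|y_{N-1}-Ty_{N-1}\|^2\le \frac{4\|y_0-y_\star\|^2}{N^2}$$ holds for every real Hilbert space $\mathcal X$, every nonexpansive $T:\mathcal X\to\mathcal X$, every fixed point $y_\star$ of $T$ and every $y_0\in\mathcal X$. For $m,j\in\{1,\dots,N-1\}$ put $$Q(m,j;H)=\sum_{j=j(1)\le i(1)<j(2)\le i(2)<\cdots<j(m)\le i(m)\le N-1}\ \prod_{r=1}^m h_{i(r),j(r)},$$ and define the H-certificates $$\lambda^\star_{N,j}(H)=N\sum_{m=1}^{N-1}(-1)^{m-1}Q(m,j;H)\quad(1\le j\le N-1),$$ $$\lambda^\star_{k,j}(H)=N\sum_{\ell=1}^{N-1}\sum_{m=1}^{N-1}(-1)^{\ell+m-1}\binom{\ell+m}{m}Q(\ell,j;H)\,Q(m,k;H)\quad(1\le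 j<k\le N-1).$$ A vertex of $\mathcal H_\star(N-1)$ is an element $H\in\mathcal H_\star(N-1)$ for which the number of pairs $1\le j<k\le N$ with $\lambda^\star_{k,j}(H)=0$ is the largest possible among all elements of $\mathcal H_\star(N-1)$. The diagram of $H$ is the graph on the nodes $\{1,\dots,N\}$ in which $j<k$ are joined if and only if $\lambda^\star_{k,j}(H)\ne 0$. An arc diagram on $N$ nodes is a simple graph on $\{1,\dots,N\}$ in which each node $j<N$ is joined to exactly one larger node. **Theorem.** (1) Let $k(1),\dots,k(N-1)$ be integers with $j<k(j)\le N$ for each $j$. Then there is exactly one $H\in\mathcal H_\star(N-1)$ such that, for each $j=1,\dots,N-1$, $\lambda^\star_{k(j),j}(H)>0$ and $\lambda^\star_{\ell,j}(H)=0$ for all $\ell\ne k(j)$ with $j<\ell\le N$. This $H$ is a vertex of $\mathcal H_\star(N-1)$. (2) $\mathcal H_\star(N-1)$ has exactly $(N-1)!$ vertices, and mapping a vertex to its diagram is a bijection from the set of vertices of $\mathcal H_\star(N-1)$ onto the set of arc diagrams on $N$ nodes. Every arc diagram is a tree. -/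

import Mathlib

/-!
Throughout, `n = N - 1` is the number of steps, so that `N = n + 1 ≥ 1`.  All indices are shifted
to start at `0`: the entry `H k j` (`k j : Fin n`) is the step size `h_{k+1, j+1}`, and the node
`a : Fin (n + 1)` stands for the node `a + 1` of `{1, …, N}`.  A node other than the last one is
written `j.castSucc` with `j : Fin n`.
-/

namespace FixedPointAlg

/-- `y 0, …, y (N - 1)` are the iterates of the fixed-step algorithm with step sizes `H`, applied to
the operator `T`: `y_{k+1} = y_k - ∑_{j ≤ k} h_{k+1,j+1} (y_j - T y_j)` for `k = 0, …, N - 2`. -/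
def IsTrajectory {n : ℕ} {X : Type} [NormedAddCommGroup X] [InnerProductSpace ℝ X]
    (H : Matrix (Fin n) (Fin n) ℝ) (T : X → X) (y : Fin (n + 1) → X) : Prop :=
  ∀ k : Fin n, y k.succ =
    y k.castSucc - ∑ j ∈ Finset.univ.filter (fun j : Fin n => j ≤ k),
      H k j • (y j.castSucc - T (y j.castSucc))

/-- The set `𝓗⋆(N - 1)`: lower triangular matrices whose algorithm satisfies the optimal rate
`‖y_{N-1} - T y_{N-1}‖² ≤ 4 ‖y_0 - y_⋆‖² / N²` for every nonexpansive operator `T` on a real Hilbert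
space, every fixed point `y_⋆` of `T` and every starting point `y_0`. -/
def optimalMatrices (n : ℕ) : Set (Matrix (Fin n) (Fin n) ℝ) :=
  {H | (∀ k j : Fin n, k < j → H k j = 0) ∧
    ∀ (X : Type) [NormedAddCommGroup X] [InnerProductSpace ℝ X] [CompleteSpace X] (T : X → X),
      (∀ u v : X, ‖T u - T v‖ ≤ ‖u - v‖) →
      ∀ yStar : X, T yStar = yStar →
      ∀ y : Fin (n + 1) → X, IsTrajectory H T y →
        ‖y (Fin.last n) - T (y (Fin.last n))‖ ^ 2 ≤
          4 * ‖y 0 - yStar‖ ^ 2 / ((n : ℝ) + 1) ^ 2}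

/-- The Q-function `Q(m, j; H)` (for `m ≥ 1`): the sum of `∏_r h_{i(r), j(r)}` over all
`j = j(1) ≤ i(1) < j(2) ≤ i(2) < ⋯ < j(m) ≤ i(m) ≤ N - 1`.  A pair `p` of functions on `Fin m`
consists of `p.1 = i` and `p.2 = (j(1), …, j(m))`. -/
def Q {n : ℕ} (H : Matrix (Fin n) (Fin n) ℝ) (m : ℕ) (j : Fin n) : ℝ :=
  ∑ p ∈ Finset.univ.filter (fun p : (Fin m → Fin n) × (Fin m → Fin n) =>
      (∀ r : Fin m, r.val = 0 → p.2 r = j) ∧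
      (∀ r : Fin m, p.2 r ≤ p.1 r) ∧
      (∀ r s : Fin m, r.val + 1 = s.val → p.1 r < p.2 s)),
    ∏ r : Fin m, H (p.1 r) (p.2 r)

/-- The H-certificate `λ⋆_{k,j}(H)`, meaningful for nodes `j < k`.  The second branch is the case in
which `k` is the last node `N`. -/
noncomputable def cert {n : ℕ} (H : Matrix (Fin n) (Fin n) ℝ) (k : Fin (n + 1)) (j : Fin n) : ℝ :=
  if hk : k.val < n then
    ((n : ℝ) + 1) * ∑ l ∈ Finset.Icc 1 n, ∑ m ∈ Finset.Icc 1 n,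
      (-1 : ℝ) ^ (l + m - 1) * ((l + m).choose m : ℝ) * Q H l j * Q H m ⟨k.val, hk⟩
  else
    ((n : ℝ) + 1) * ∑ m ∈ Finset.Icc 1 n, (-1 : ℝ) ^ (m - 1) * Q H m j

/-- The sparsity pattern prescribed by `k(1), …, k(N-1)`: for every `j`, the certificate
`λ⋆_{k(j),j}(H)` is positive and the other `λ⋆_{l,j}(H)` with `l > j` vanish. -/
def HasSparsityPattern {n : ℕ} (H : Matrix (Fin n) (Fin n) ℝ) (k : Fin n → Fin (n + 1)) : Prop :=
  ∀ j : Fin n, 0 < cert H (k j) j ∧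
    ∀ l : Fin (n + 1), j.castSucc < l → l ≠ k j → cert H l j = 0

/-- The number of vanishing H-certificates `λ⋆_{k,j}(H)`, `1 ≤ j < k ≤ N`, i.e. the number of their
zero sets on which `H` lies. -/
noncomputable def zeroCount {n : ℕ} (H : Matrix (Fin n) (Fin n) ℝ) : ℕ :=
  Set.ncard {p : Fin (n + 1) × Fin n | p.2.castSucc < p.1 ∧ cert H p.1 p.2 = 0}

/-- The vertices of `𝓗⋆(N - 1)`: the points that lie on a maximal number of zero sets of
H-certificates, i.e. the optimal matrices with the sparsest convergence proofs. -/
def vertices (n : ℕ) : Set (Matrix (Fin n) (Fin n) ℝ) :=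
  {H | H ∈ optimalMatrices n ∧ ∀ H' ∈ optimalMatrices n, zeroCount H' ≤ zeroCount H}

/-- The (support graph of the) diagram of `H`: nodes `j < k` are joined if `λ⋆_{k,j}(H) ≠ 0`. -/
noncomputable def diagram {n : ℕ} (H : Matrix (Fin n) (Fin n) ℝ) : SimpleGraph (Fin (n + 1)) :=
  SimpleGraph.fromRel
    (fun k a => ∃ j : Fin n, a = j.castSucc ∧ a < k ∧ cert H k j ≠ 0)

/-- Arc diagrams on `N` nodes: every node except the last one is joined to exactly one larger
node. -/
def IsArcDiagram {n : ℕ} (G : SimpleGraph (Fin (n + 1))) : Prop :=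
  ∀ j : Fin n, ∃! k : Fin (n + 1), j.castSucc < k ∧ G.Adj j.castSucc k

end FixedPointAlg

/-!
Write `N = n + 1` and let `B = cumul H` be the strictly lower triangular matrix with
`y_a = y_0 - ∑_b B a b • (y_b - T y_b)`. The path sums `Q H m` are the last row of `B ^ m`
(`Q_eq_pow`). By Vandermonde's identity the certificates are therefore the off-diagonal entries of a
Gram matrix, `N * cert H k j = -(Uᵀ * U) k j`, where the lower triangular matrix `U = factor B` has
in its row `n - i` the last row of `N * B ^ i * (1 + B) ^ (-i - 1)` (`cert_eq`). Two relations hold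
for every `H` and characterize `U`: its column sums are `0, …, 0, N`, and `U * B = E * U`, where `E`
is the matrix of ones below the diagonal (`sum_factor`, `factor_mul`, `eq_factor_of_mul`).

*Optimality.* If `H` is optimal, then all row sums of `U` are one: for the negacyclic shift on
Euclidean space, started at the vector of ones, the last displacement has the entries `2 / N` times
these row sums, which add up to `N`, so the optimal rate forces equality in the Cauchy–Schwarz
inequality (`sum_factor_row_of_optimal`). Conversely, if the row sums are one and the certificates
are nonnegative, then the sum of the monotonicity inequalities with the certificates as weights
proves the optimal rate, because `U * B = E * U` and `E + Eᵀ + 1` has all entries one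
(`mem_optimalMatrices`). For an optimal `H` the matrix `U` is invertible, and each `j` has some
nonvanishing certificate (`exists_cert_ne_zero`); hence at most all but `n` certificates vanish, and
the vertices are the optimal matrices with one nonvanishing certificate for each `j`.

*Sparsity patterns.* If `cert H l j` vanishes for all `l ≠ k j`, then `Uᵀ * U` is `N` times the
Laplacian of the tree with parent function `k`, weighted by the certificates, plus one at the root
(`gram_eq_treeLap`). The weights are positive by positive definiteness (`cert_pos`). The partial row
sums of `N • U⁻¹` are electrical potentials in this network with the nodes `0, …, t - 1` grounded,
and the relations for `U` say exactly that the conductance between the root and the grounded nodes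
is `t / (N - t)` for every `t ≤ n` (`nodeCond_cert`). Such data are attained by exactly one choice of
positive edge weights: grounding one more node changes the conductance of only one of the branches
at the root, so the conductances of the branches, and by the series law those of the subtrees below,
are forced from the root downwards (`eq_of_nodeCond_last_eq`, `targetMono`). The weights determine
`Uᵀ * U`, which determines `B` because a strictly lower triangular skew-symmetric matrix vanishes
(`eq_of_gram_eq`). Conversely, the potentials of the network with the forced weights yield `U⁻¹`
(`exists_factor`).
-/

namespace FixedPointAlg

open Finset Matrix

variable {n : ℕ} {B : Matrix (Fin (n + 1)) (Fin (n + 1)) ℝ}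

/-! ### Path sums -/

/-- The sum defining `Q`, with the condition `j(1) = j` replaced by `j(1) > i`. For `m = 0` it is
the empty product `1`. -/
def tailSum (H : Matrix (Fin n) (Fin n) ℝ) (m : ℕ) (i : Fin n) : ℝ :=
  ∑ p : (Fin m → Fin n) × (Fin m → Fin n),
    if (∀ r : Fin m, r.val = 0 → i < p.2 r) ∧ (∀ r : Fin m, p.2 r ≤ p.1 r) ∧
      (∀ r s : Fin m, r.val + 1 = s.val → p.1 r < p.2 s) then ∏ r : Fin m, H (p.1 r) (p.2 r) else 0

lemma tailSum_zero (H : Matrix (Fin n) (Fin n) ℝ) (i : Fin n) : tailSum H 0 i = 1 := by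
  simp [tailSum]

/-- A chain of length `m + 1` is its first pair followed by a chain of length `m`. -/
def pairConsEquiv (m n : ℕ) :
    ((Fin n × Fin n) × ((Fin m → Fin n) × (Fin m → Fin n))) ≃
      ((Fin (m + 1) → Fin n) × (Fin (m + 1) → Fin n)) where
  toFun x := (Fin.cons x.1.1 x.2.1, Fin.cons x.1.2 x.2.2)
  invFun y := ((y.1 0, y.2 0), (Fin.tail y.1, Fin.tail y.2))
  left_inv x := by simp
  right_inv y := by simp

lemma forall_succ_chain {m : ℕ} (f g : Fin m → Fin n) (i j : Fin n) :
    (∀ r s : Fin (m + 1), r.val + 1 = s.val →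
      (Fin.cons i f : Fin (m + 1) → Fin n) r < (Fin.cons j g : Fin (m + 1) → Fin n) s) ↔
    (∀ r : Fin m, r.val = 0 → i < g r) ∧ ∀ r s : Fin m, r.val + 1 = s.val → f r < g s := by
  simp only [Fin.forall_fin_succ, Fin.cons_zero, Fin.cons_succ, Fin.val_zero, Fin.val_succ]
  constructor
  · rintro ⟨⟨-, h1⟩, h2⟩
    exact ⟨fun r hr => h1 r (by omega), fun r s hrs => (h2 r).2 s (by omega)⟩
  · rintro ⟨h1, h2⟩
    exact ⟨⟨by simp, fun r hr => h1 r (by omega)⟩,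
      fun r => ⟨by simp, fun s hs => h2 r s (by omega)⟩⟩

lemma Q_succ (H : Matrix (Fin n) (Fin n) ℝ) (m : ℕ) (j : Fin n) :
    Q H (m + 1) j = ∑ i, if j ≤ i then H i j * tailSum H m i else 0 := by
  unfold Q tailSum
  rw [sum_filter, ← (pairConsEquiv m n).sum_comp, Fintype.sum_prod_type, Fintype.sum_prod_type]
  refine sum_congr rfl fun i _ => ?_
  rw [sum_eq_single j]
  · split_ifs with hij
    · rw [mul_sum]
      refine sum_congr rfl fun p _ => ?_
      simp only [pairConsEquiv, Equiv.coe_fn_mk, forall_succ_chain, Fin.prod_univ_succ,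
        Fin.cons_zero, Fin.cons_succ, mul_ite, mul_zero]
      refine if_congr ?_ rfl rfl
      simp only [Fin.forall_fin_succ, Fin.cons_zero, Fin.cons_succ, Fin.val_zero, Fin.val_succ]
      simp only [hij, true_and, Nat.add_eq_zero_iff, one_ne_zero, and_false,
        false_imp_iff, implies_true]
      tauto
    · refine sum_eq_zero fun p _ => if_neg ?_
      rintro ⟨-, h, -⟩
      exact hij (by simpa [pairConsEquiv] using h 0)
  · intro j' _ hj'
    refine sum_eq_zero fun p _ => if_neg ?_
    rintro ⟨h, -⟩
    exact hj' (by simpa [pairConsEquiv] using h 0 rfl)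
  · simp

lemma tailSum_succ (H : Matrix (Fin n) (Fin n) ℝ) (m : ℕ) (i : Fin n) :
    tailSum H (m + 1) i = ∑ j, if i < j then Q H (m + 1) j else 0 := by
  unfold Q tailSum
  simp only [sum_filter]
  simp only [← sum_filter (fun j => i < j)]
  rw [sum_comm]
  refine sum_congr rfl fun p _ => ?_
  simp only [Fin.forall_fin_succ (P := fun r => _ → _ = _),
    Fin.forall_fin_succ (P := fun r : Fin (m + 1) => r.val = 0 → i < p.2 r)]
  simp only [Fin.val_zero, forall_true_left, Fin.val_succ, Nat.add_eq_zero_iff, one_ne_zero,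
    and_false, false_imp_iff, implies_true, and_true]
  rw [sum_filter]
  rw [sum_eq_single (p.2 0)]
  · by_cases h : i < p.2 0 <;> simp [h]
  · intro j _ hj
    simp [hj.symm]
  · simp

/-! ### Cumulative step sizes -/

/-- The cumulative step sizes `B`, with `B a b = ∑_{b ≤ i < a} H i b`: the iterates satisfy
`y_a = y_0 - ∑_b B a b • (y_b - T y_b)`. -/
def cumul (H : Matrix (Fin n) (Fin n) ℝ) : Matrix (Fin (n + 1)) (Fin (n + 1)) ℝ :=
  fun a b => ∑ i : Fin n, ∑ j : Fin n,
    if j.castSucc = b ∧ j ≤ i ∧ i.castSucc < a then H i j else 0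

lemma cumul_castSucc (H : Matrix (Fin n) (Fin n) ℝ) (a : Fin (n + 1)) (j : Fin n) :
    cumul H a j.castSucc = ∑ i : Fin n, if j ≤ i ∧ i.castSucc < a then H i j else 0 := by
  unfold cumul
  refine sum_congr rfl fun i _ => ?_
  rw [sum_eq_single j]
  · simp
  · intro j' _ hj'
    simp [hj']
  · simp

lemma cumul_last_right (H : Matrix (Fin n) (Fin n) ℝ) (a : Fin (n + 1)) :
    cumul H a (Fin.last n) = 0 := by
  refine sum_eq_zero fun i _ => sum_eq_zero fun j _ => if_neg ?_
  rintro ⟨h, -⟩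
  exact absurd h (Fin.castSucc_lt_last j).ne

lemma cumul_eq_zero (H : Matrix (Fin n) (Fin n) ℝ) {a b : Fin (n + 1)} (hab : a ≤ b) :
    cumul H a b = 0 := by
  refine sum_eq_zero fun i _ => sum_eq_zero fun j _ => if_neg ?_
  rintro ⟨rfl, h1, h2⟩
  rw [Fin.le_def] at hab h1
  rw [Fin.lt_def] at h2
  simp only [Fin.val_castSucc] at *
  omega

lemma cumul_succ_left (H : Matrix (Fin n) (Fin n) ℝ) (k j : Fin n) :
    cumul H k.succ j.castSucc = cumul H k.castSucc j.castSucc + if j ≤ k then H k j else 0 := by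
  rw [cumul_castSucc, cumul_castSucc]
  have : (if j ≤ k then H k j else 0) =
      ∑ i : Fin n, if i = k then (if j ≤ i then H i j else 0) else 0 := by simp
  rw [this, ← sum_add_distrib]
  refine sum_congr rfl fun i _ => ?_
  simp only [Fin.lt_def, Fin.val_castSucc, Fin.val_succ, Fin.ext_iff]
  split_ifs <;> first | omega | simp

lemma cumul_last_left (H : Matrix (Fin n) (Fin n) ℝ) (j : Fin n) :
    cumul H (Fin.last n) j.castSucc = ∑ i : Fin n, if j ≤ i then H i j else 0 := by
  rw [cumul_castSucc]
  simp [Fin.castSucc_lt_last]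

/-- A lower triangular matrix is determined by its cumulative step sizes. -/
lemma eq_of_cumul_eq {H H' : Matrix (Fin n) (Fin n) ℝ} (hH : ∀ k j : Fin n, k < j → H k j = 0)
    (hH' : ∀ k j : Fin n, k < j → H' k j = 0) (h : cumul H = cumul H') : H = H' := by
  ext k j
  rcases lt_or_ge k j with hkj | hkj
  · rw [hH k j hkj, hH' k j hkj]
  · have h1 := cumul_succ_left H k j
    have h2 := cumul_succ_left H' k j
    rw [h, if_pos hkj] at h1
    rw [if_pos hkj] at h2
    linarith

/-- Every strictly lower triangular matrix is a matrix of cumulative step sizes. -/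
lemma exists_cumul_eq {B : Matrix (Fin (n + 1)) (Fin (n + 1)) ℝ}
    (hB : ∀ a b, a ≤ b → B a b = 0) :
    ∃ H : Matrix (Fin n) (Fin n) ℝ, (∀ k j : Fin n, k < j → H k j = 0) ∧ cumul H = B := by
  refine ⟨Matrix.of fun k j => B k.succ j.castSucc - B k.castSucc j.castSucc, ?_, ?_⟩
  · intro k j hkj
    have h1 : k.succ ≤ j.castSucc := by
      rw [Fin.lt_def] at hkj
      rw [Fin.le_def, Fin.val_succ, Fin.val_castSucc]
      omega
    rw [of_apply, hB _ _ h1, hB _ _ (Fin.castSucc_lt_succ.le.trans h1), sub_zero]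
  · ext a b
    refine Fin.lastCases ?_ (fun j => ?_) b
    · rw [cumul_last_right, hB _ _ (Fin.le_last a)]
    · refine Fin.induction ?_ (fun k ih => ?_) a
      · rw [cumul_eq_zero _ (Fin.zero_le _), hB _ _ (Fin.zero_le _)]
      · rw [cumul_succ_left, ih, of_apply]
        split_ifs with h
        · ring
        · have h' : k.succ ≤ j.castSucc := by
            simp only [Fin.le_def, Fin.val_castSucc, Fin.val_succ] at h ⊢; omega
          rw [hB _ _ h', hB _ _ ((Fin.castSucc_lt_succ).le.trans h'), add_zero]

lemma pow_eq_zero_of_lt {B : Matrix (Fin (n + 1)) (Fin (n + 1)) ℝ}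
    (hB : ∀ a b, a ≤ b → B a b = 0) (m : ℕ) {a b : Fin (n + 1)} (hab : a.val < b.val + m) :
    (B ^ m) a b = 0 := by
  induction m generalizing b with
  | zero => exact one_apply_ne (Fin.ne_of_lt hab)
  | succ m ih =>
    rw [pow_succ, mul_apply]
    refine sum_eq_zero fun c _ => ?_
    rcases le_or_gt c b with h | h
    · rw [hB c b h, mul_zero]
    · rw [ih (by rw [Fin.lt_def] at h; omega), zero_mul]

lemma strictLower_pow_eq_zero {B : Matrix (Fin (n + 1)) (Fin (n + 1)) ℝ}
    (hB : ∀ a b, a ≤ b → B a b = 0) : B ^ (n + 1) = 0 := by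
  ext a b
  exact pow_eq_zero_of_lt hB _ (by omega)

/-- `Q H m` is the last row of the `m`-th power of the cumulative step sizes. -/
lemma Q_eq_pow (H : Matrix (Fin n) (Fin n) ℝ) (m : ℕ) (j : Fin n) :
    Q H (m + 1) j = (cumul H ^ (m + 1)) (Fin.last n) j.castSucc := by
  induction m generalizing j with
  | zero =>
    rw [Q_succ, zero_add, pow_one, cumul_last_left]
    simp [tailSum_zero]
  | succ m ih =>
    rw [Q_succ, pow_succ, mul_apply, Fin.sum_univ_castSucc,
      pow_eq_zero_of_lt (fun _ _ => cumul_eq_zero H) (m + 1) (b := Fin.last n) (by omega)]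
    simp only [← ih, tailSum_succ, cumul_castSucc, mul_sum]
    simp only [zero_mul, sum_const_zero, add_zero]
    rw [sum_comm]
    refine sum_congr rfl fun i _ => ?_
    by_cases hij : j ≤ i
    · simp only [hij, if_true, true_and]
      refine sum_congr rfl fun a _ => ?_
      simp [mul_comm]
    · simp [hij]

/-! ### The factor of the certificates -/

/-- The matrix `B ^ i * (1 + B) ^ (-i - 1)`, written as the binomial series that breaks off because
`B ^ (n + 1) = 0`. -/
def krylov (B : Matrix (Fin (n + 1)) (Fin (n + 1)) ℝ) (i : ℕ) :
    Matrix (Fin (n + 1)) (Fin (n + 1)) ℝ :=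
  ∑ l ∈ range (n + 1), ((-1 : ℝ) ^ (l + i) * (l.choose i : ℝ)) • B ^ l

lemma krylov_mul (B : Matrix (Fin (n + 1)) (Fin (n + 1)) ℝ) (i : ℕ) :
    krylov B i * B = B * krylov B i := by
  simp [krylov, sum_mul, mul_sum, ← pow_succ, ← pow_succ']

/-- `krylov B 0` is the inverse of `1 + B`. -/
lemma krylov_zero_mul (hB : ∀ a b, a ≤ b → B a b = 0) : krylov B 0 + krylov B 0 * B = 1 := by
  have h1 : krylov B 0 * B = ∑ l ∈ range (n + 1), ((-1 : ℝ) ^ l) • B ^ (l + 1) := by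
    simp [krylov, sum_mul, ← pow_succ]
  have h2 : krylov B 0 = ∑ l ∈ range n, (-(-1 : ℝ) ^ l) • B ^ (l + 1) + 1 := by
    simp [krylov, sum_range_succ', pow_succ]
  rw [h1, h2, sum_range_succ, strictLower_pow_eq_zero hB]
  simp

/-- Pascal's rule for the binomial series. -/
lemma krylov_succ_mul (hB : ∀ a b, a ≤ b → B a b = 0) (i : ℕ) :
    krylov B (i + 1) + krylov B (i + 1) * B = krylov B i * B := by
  have h1 : ∀ i, krylov B i * B =
      ∑ l ∈ range n, ((-1 : ℝ) ^ (l + i) * (l.choose i : ℝ)) • B ^ (l + 1) := by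
    intro i
    rw [krylov, sum_range_succ]
    simp [add_mul, sum_mul, ← pow_succ, strictLower_pow_eq_zero hB]
  have h2 : krylov B (i + 1) = ∑ l ∈ range n,
      ((-1 : ℝ) ^ (l + i) * ((l + 1).choose (i + 1) : ℝ)) • B ^ (l + 1) := by
    rw [krylov, sum_range_succ']
    simp only [Nat.choose_zero_succ, Nat.cast_zero, mul_zero, zero_smul, add_zero]
    exact sum_congr rfl fun l _ => by rw [show l + 1 + (i + 1) = l + i + 2 by ring, pow_add]; simp
  rw [h1, h1, h2, ← sum_add_distrib]
  refine sum_congr rfl fun l _ => ?_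
  rw [← add_smul, Nat.choose_succ_succ, ← add_assoc l i 1, pow_succ]
  push_cast
  congr 1
  ring

lemma krylov_apply_eq_zero (hB : ∀ a b, a ≤ b → B a b = 0) {i : ℕ} {a b : Fin (n + 1)}
    (h : a.val < b.val + i) : krylov B i a b = 0 := by
  rw [krylov, Matrix.sum_apply]
  refine sum_eq_zero fun l _ => ?_
  rw [Matrix.smul_apply]
  rcases lt_or_ge l i with hl | hl
  · simp [Nat.choose_eq_zero_of_lt hl]
  · rw [pow_eq_zero_of_lt hB l (by omega), smul_zero]

/-- The lower triangular matrix `U` whose Gram matrix carries the certificates: the row `n - i` is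
`N` times the last row of `krylov B i`. -/
def factor (B : Matrix (Fin (n + 1)) (Fin (n + 1)) ℝ) : Matrix (Fin (n + 1)) (Fin (n + 1)) ℝ :=
  fun r j => ((n : ℝ) + 1) * krylov B (n - r.val) (Fin.last n) j

/-- The strictly lower triangular matrix of ones. -/
def belowDiag (n : ℕ) : Matrix (Fin (n + 1)) (Fin (n + 1)) ℝ :=
  fun r s => if s < r then 1 else 0

lemma factor_eq_zero (hB : ∀ a b, a ≤ b → B a b = 0) {r j : Fin (n + 1)} (h : r < j) :
    factor B r j = 0 := by
  rw [factor, krylov_apply_eq_zero hB, mul_zero]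
  rw [Fin.lt_def] at h
  simp only [Fin.val_last]
  omega

lemma belowDiag_mul_succ (A : Matrix (Fin (n + 1)) (Fin (n + 1)) ℝ) (r : Fin n)
    (j : Fin (n + 1)) :
    (belowDiag n * A) r.succ j = (belowDiag n * A) r.castSucc j + A r.castSucc j := by
  have h : A r.castSucc j = ∑ s, if s = r.castSucc then A s j else 0 := by simp
  rw [mul_apply, mul_apply, h, ← sum_add_distrib]
  refine sum_congr rfl fun s _ => ?_
  simp only [belowDiag, ite_mul, one_mul, zero_mul, Fin.lt_def, Fin.ext_iff, Fin.val_succ,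
    Fin.val_castSucc]
  split_ifs <;> first | omega | simp

lemma factor_castSucc (hB : ∀ a b, a ≤ b → B a b = 0) (r : Fin n) (j : Fin (n + 1)) :
    factor B r.castSucc j + (factor B * B) r.castSucc j = (factor B * B) r.succ j := by
  have h := congrFun (congrFun (krylov_succ_mul hB (n - r.succ.val)) (Fin.last n)) j
  have h' : n - r.succ.val + 1 = n - r.castSucc.val := by
    simp only [Fin.val_succ, Fin.val_castSucc]; omega
  rw [h'] at h
  simp only [Matrix.add_apply, mul_apply] at h
  simp only [factor, mul_apply, mul_assoc, ← mul_sum, ← mul_add, h]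

lemma factor_last (hB : ∀ a b, a ≤ b → B a b = 0) (j : Fin (n + 1)) :
    factor B (Fin.last n) j + (factor B * B) (Fin.last n) j =
      if j = Fin.last n then (n : ℝ) + 1 else 0 := by
  have h := congrFun (congrFun (krylov_zero_mul hB) (Fin.last n)) j
  simp only [Matrix.add_apply, mul_apply, one_apply] at h
  simp only [factor, mul_apply, mul_assoc, ← mul_sum, ← mul_add, Fin.val_last, Nat.sub_self, h]
  simp [eq_comm]

/-- In the basis given by the rows of `factor B`, the cumulative step sizes become the matrix of
ones below the diagonal, whatever the algorithm. -/
lemma factor_mul (hB : ∀ a b, a ≤ b → B a b = 0) : factor B * B = belowDiag n * factor B := by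
  ext r j
  refine Fin.induction ?_ (fun r ih => ?_) r
  · have h : belowDiag n 0 = 0 := by ext s; simp [belowDiag]
    rw [mul_apply, mul_apply, h]
    simp only [Pi.zero_apply, zero_mul, sum_const_zero]
    refine sum_eq_zero fun s _ => ?_
    rcases eq_or_ne s 0 with rfl | hs
    · rw [hB _ _ (Fin.zero_le _), mul_zero]
    · rw [factor_eq_zero hB (Fin.pos_of_ne_zero hs), zero_mul]
  · rw [belowDiag_mul_succ, ← ih, ← factor_castSucc hB, add_comm]

lemma sum_factor (hB : ∀ a b, a ≤ b → B a b = 0) (j : Fin (n + 1)) :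
    ∑ r, factor B r j = if j = Fin.last n then (n : ℝ) + 1 else 0 := by
  rw [← factor_last hB, factor_mul hB, mul_apply, Fin.sum_univ_castSucc,
    Fin.sum_univ_castSucc (f := fun s => belowDiag n (Fin.last n) s * _)]
  simp [belowDiag, Fin.castSucc_lt_last, add_comm]

/-- The relations `factor_mul` and `sum_factor` determine the factor. -/
lemma eq_factor_of_mul {U : Matrix (Fin (n + 1)) (Fin (n + 1)) ℝ}
    (hB : ∀ a b, a ≤ b → B a b = 0) (hU : U * B = belowDiag n * U)
    (hsum : ∀ j, ∑ r, U r j = if j = Fin.last n then (n : ℝ) + 1 else 0) : U = factor B := by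
  have hinj : ∀ x : Fin (n + 1) → ℝ, x + x ᵥ* B = 0 → x = 0 := by
    intro x hx
    have h : x ᵥ* (1 + B) = 0 := by rwa [vecMul_add, vecMul_one]
    have hinv : (1 + B) * krylov B 0 = 1 := by
      rw [add_mul, one_mul, ← krylov_mul, krylov_zero_mul hB]
    rw [← vecMul_one x, ← hinv, ← vecMul_vecMul, h, zero_vecMul]
  have hlast : ∀ j, U (Fin.last n) j + (U * B) (Fin.last n) j =
      if j = Fin.last n then (n : ℝ) + 1 else 0 := by
    intro j
    rw [← hsum, hU, mul_apply, Fin.sum_univ_castSucc,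
      Fin.sum_univ_castSucc (f := fun r => U r j)]
    simp [belowDiag, Fin.castSucc_lt_last, add_comm]
  have key : ∀ r, U r = factor B r := by
    intro r
    refine Fin.reverseInduction ?_ (fun r ih => ?_) r
    · refine sub_eq_zero.1 (hinj _ ?_)
      ext j
      have h1 := hlast j
      have h2 := factor_last hB j
      simp only [mul_apply_eq_vecMul] at h1 h2
      simp only [sub_vecMul, Pi.add_apply, Pi.sub_apply, Pi.zero_apply]
      linarith
    · refine sub_eq_zero.1 (hinj _ ?_)
      ext j
      have h1 : U r.castSucc j + (U * B) r.castSucc j = (U * B) r.succ j := by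
        rw [hU, belowDiag_mul_succ, add_comm]
      have h2 := factor_castSucc hB r j
      simp only [mul_apply_eq_vecMul, ih] at h1 h2
      simp only [sub_vecMul, Pi.add_apply, Pi.sub_apply, Pi.zero_apply]
      linarith
  exact funext key

lemma sum_range_choose_mul_choose {l m k : ℕ} (hm : m ≤ k) :
    ∑ i ∈ range (k + 1), (l.choose i : ℝ) * (m.choose i : ℝ) = ((l + m).choose m : ℝ) := by
  rw [Nat.add_choose_eq, Nat.sum_antidiagonal_eq_sum_range_succ (fun a b => l.choose a * m.choose b)]
  push_cast
  symm
  refine (sum_congr rfl fun i hi => ?_).trans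
    (sum_subset (range_subset_range.2 (by omega)) fun i _ hi => ?_)
  · rw [Nat.choose_symm (by simpa [Nat.lt_succ_iff] using hi)]
  · rw [Nat.choose_eq_zero_of_lt (n := m) (by simpa [Nat.lt_succ_iff] using hi)]
    simp

lemma gram_factor (B : Matrix (Fin (n + 1)) (Fin (n + 1)) ℝ) (k j : Fin (n + 1)) :
    ∑ r, factor B r k * factor B r j = ((n : ℝ) + 1) ^ 2 *
      ∑ l ∈ range (n + 1), ∑ m ∈ range (n + 1), (-1 : ℝ) ^ (l + m) * ((l + m).choose m : ℝ) *
        (B ^ l) (Fin.last n) j * (B ^ m) (Fin.last n) k := by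
  have h1 : ∑ r, factor B r k * factor B r j = ((n : ℝ) + 1) ^ 2 *
      ∑ i ∈ range (n + 1), krylov B i (Fin.last n) k * krylov B i (Fin.last n) j := by
    rw [← Fin.sum_univ_eq_sum_range
      (fun i => krylov B i (Fin.last n) k * krylov B i (Fin.last n) j), ← Equiv.sum_comp Fin.revPerm,
      mul_sum]
    refine sum_congr rfl fun r _ => ?_
    have : n - (Fin.revPerm r).val = r.val := by simp; omega
    rw [factor, factor, this]
    ring
  rw [h1]
  congr 1
  have h2 : ∀ l ∈ range (n + 1), ∀ m ∈ range (n + 1),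
      (-1 : ℝ) ^ (l + m) * ((l + m).choose m : ℝ) * (B ^ l) (Fin.last n) j *
        (B ^ m) (Fin.last n) k = ∑ i ∈ range (n + 1),
          ((-1 : ℝ) ^ (m + i) * (m.choose i : ℝ) * (B ^ m) (Fin.last n) k) *
          ((-1 : ℝ) ^ (l + i) * (l.choose i : ℝ) * (B ^ l) (Fin.last n) j) := by
    intro l _ m hm
    rw [← sum_range_choose_mul_choose (show m ≤ n by simpa [Nat.lt_succ_iff] using hm), mul_sum,
      sum_mul, sum_mul]
    refine sum_congr rfl fun i _ => ?_
    have hsq : ((-1 : ℝ) ^ i) ^ 2 = 1 := by rw [← pow_mul, mul_comm, pow_mul]; simp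
    rw [pow_add, pow_add, pow_add]
    linear_combination (-(-1 : ℝ) ^ l * (-1 : ℝ) ^ m * (l.choose i : ℝ) * (m.choose i : ℝ) *
      (B ^ l) (Fin.last n) j * (B ^ m) (Fin.last n) k) * hsq
  rw [sum_congr rfl fun l hl => sum_congr rfl fun m hm => h2 l hl m hm, sum_comm,
    sum_congr rfl fun m _ => sum_comm, sum_comm]
  refine sum_congr rfl fun i _ => ?_
  simp only [krylov, Matrix.sum_apply, Matrix.smul_apply, smul_eq_mul, sum_mul_sum]

/-- The certificates are the off-diagonal entries of the Gram matrix of the columns of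
`factor (cumul H)`, up to the factor `-1 / N`. -/
lemma cert_eq (H : Matrix (Fin n) (Fin n) ℝ) (k : Fin (n + 1)) (j : Fin n)
    (hjk : j.castSucc < k) :
    ((n : ℝ) + 1) * cert H k j =
      -∑ r, factor (cumul H) r k * factor (cumul H) r j.castSucc := by
  have hIcc : ∀ f : ℕ → ℝ, ∑ m ∈ Icc 1 n, f m = ∑ m ∈ range n, f (m + 1) := by
    intro f
    rw [range_eq_Ico, sum_Ico_add' f 0 n 1]
    rfl
  have h0 : ((1 : Matrix (Fin (n + 1)) (Fin (n + 1)) ℝ)) (Fin.last n) j.castSucc = 0 :=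
    one_apply_ne (Fin.castSucc_lt_last j).ne'
  rw [gram_factor, sum_range_succ']
  simp only [pow_zero, h0, mul_zero, zero_mul, sum_const_zero, add_zero]
  rcases Fin.eq_castSucc_or_eq_last k with ⟨k, rfl⟩ | rfl
  swap
  · have hm : ∀ m, (cumul H ^ (m + 1)) (Fin.last n) (Fin.last n) = 0 := fun m =>
      pow_eq_zero_of_lt (fun _ _ => cumul_eq_zero H) (m + 1) (by omega)
    rw [cert, dif_neg (by simp), hIcc]
    simp only [sum_range_succ' (n := n), hm]
    simp only [mul_zero, sum_const_zero, zero_add, Q_eq_pow, pow_zero, one_apply_eq, mul_one,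
      Nat.choose_zero_right, Nat.cast_one, add_zero, Nat.add_sub_cancel, mul_sum, ← sum_neg_distrib]
    exact sum_congr rfl fun m _ => by rw [pow_succ]; ring
  · have hk : ((1 : Matrix (Fin (n + 1)) (Fin (n + 1)) ℝ)) (Fin.last n) k.castSucc = 0 :=
      one_apply_ne (Fin.castSucc_lt_last k).ne'
    rw [cert, dif_pos (by simp)]
    simp only [hIcc, sum_range_succ' (n := n), pow_zero, hk]
    simp only [mul_zero, add_zero, Q_eq_pow, mul_sum, ← sum_neg_distrib]
    refine sum_congr rfl fun l _ => sum_congr rfl fun m _ => ?_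
    rw [show l + 1 + (m + 1) - 1 = l + m + 1 by omega,
      show l + 1 + (m + 1) = l + m + 1 + 1 by omega, pow_succ _ (l + m + 1)]
    simp only [Fin.castSucc, Fin.val_castAdd]
    ring

/-! ### Optimal algorithms have a factor with row sums one -/

lemma isTrajectory_iff {X : Type} [NormedAddCommGroup X] [InnerProductSpace ℝ X]
    (H : Matrix (Fin n) (Fin n) ℝ) (T : X → X) (y : Fin (n + 1) → X) :
    IsTrajectory H T y ↔ ∀ a, y a = y 0 - ∑ b, cumul H a b • (y b - T (y b)) := by
  have step : ∀ k : Fin n, ∑ b, cumul H k.succ b • (y b - T (y b)) =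
      ∑ b, cumul H k.castSucc b • (y b - T (y b)) + ∑ j ∈ Finset.univ.filter (fun j : Fin n => j ≤ k),
      H k j • (y j.castSucc - T (y j.castSucc)) := by
    intro k
    rw [Fin.sum_univ_castSucc, Fin.sum_univ_castSucc, cumul_last_right, cumul_last_right, zero_smul,
      add_zero, add_zero, sum_filter, ← sum_add_distrib]
    refine sum_congr rfl fun j _ => ?_
    rw [cumul_succ_left, add_smul, ite_smul, zero_smul]
  constructor
  · intro h a
    refine Fin.induction ?_ (fun k ih => ?_) a
    · simp [cumul_eq_zero H (Fin.zero_le _)]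
    · rw [h k, step, ih]
      abel
  · intro h k
    rw [h k.succ, step, h k.castSucc]
    abel

/-- The negacyclic shift `(x_0, …, x_n) ↦ (-x_n, x_0, …, x_{n-1})`. -/
noncomputable def negShift (n : ℕ) (x : EuclideanSpace ℝ (Fin (n + 1))) :
    EuclideanSpace ℝ (Fin (n + 1)) :=
  WithLp.toLp 2 (Fin.cons (-x (Fin.last n)) fun i : Fin n => x i.castSucc)

@[simp] lemma negShift_zero (x : EuclideanSpace ℝ (Fin (n + 1))) :
    negShift n x 0 = -x (Fin.last n) := rfl

@[simp] lemma negShift_succ (x : EuclideanSpace ℝ (Fin (n + 1))) (i : Fin n) :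
    negShift n x i.succ = x i.castSucc := by simp [negShift]

lemma norm_negShift_sub (u v : EuclideanSpace ℝ (Fin (n + 1))) :
    ‖negShift n u - negShift n v‖ = ‖u - v‖ := by
  rw [EuclideanSpace.norm_eq, EuclideanSpace.norm_eq, Fin.sum_univ_succ,
    Fin.sum_univ_castSucc (f := fun i => ‖(u - v) i‖ ^ 2), add_comm]
  simp only [PiLp.sub_apply, negShift_zero, negShift_succ, Real.norm_eq_abs, sq_abs]
  congr 2
  ring

/-- The worst-case operator is the negacyclic shift, started at the vector of ones: the last
displacement has the entries `2 / N` times the row sums of `factor (cumul H)`. These sum up to `N`,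
while the optimal rate bounds their sum of squares by `N`. -/
lemma sum_factor_row_of_optimal {H : Matrix (Fin n) (Fin n) ℝ} (hH : H ∈ optimalMatrices n)
    (r : Fin (n + 1)) : ∑ j, factor (cumul H) r j = 1 := by
  set B := cumul H with hBdef
  have hB : ∀ a b, a ≤ b → B a b = 0 := fun a b => cumul_eq_zero H
  let g : Fin (n + 1) → EuclideanSpace ℝ (Fin (n + 1)) := fun a =>
    WithLp.toLp 2 fun i => 2 * ∑ j, krylov B i.val a j
  let y : Fin (n + 1) → EuclideanSpace ℝ (Fin (n + 1)) := fun a =>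
    WithLp.toLp 2 fun i => 1 - ∑ b, B a b * g b i
  have hBg : ∀ a (i : Fin (n + 1)), ∑ b, B a b * g b i = 2 * ∑ j, (krylov B i.val * B) a j := by
    intro a i
    rw [krylov_mul]
    simp only [g, mul_apply, mul_sum]
    rw [sum_comm]
    exact sum_congr rfl fun _ _ => sum_congr rfl fun _ _ => by ring
  have hg : ∀ a, y a - negShift n (y a) = g a := by
    intro a
    ext i
    refine Fin.cases ?_ (fun i => ?_) i
    · have h1 : ∀ j, krylov B 0 a j + (krylov B 0 * B) a j =
          (1 : Matrix (Fin (n + 1)) (Fin (n + 1)) ℝ) a j := fun j =>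
        congrFun (congrFun (krylov_zero_mul hB) a) j
      -- the sign in the shift is harmless because the last entry involves `B ^ (n + 1) = 0`
      have h2 : ∀ j, (krylov B n * B) a j = 0 := by
        intro j
        have h3 : krylov B (n + 1) = 0 := by
          ext a b
          exact krylov_apply_eq_zero hB (by omega)
        rw [← krylov_succ_mul hB, h3]
        simp
      have h4 : ∑ j, krylov B 0 a j + ∑ j, (krylov B 0 * B) a j = 1 := by
        rw [← sum_add_distrib, sum_congr rfl fun j _ => h1 j]
        simp [one_apply]
      simp only [PiLp.sub_apply, negShift_zero, y, hBg, Fin.val_zero, Fin.val_last, h2, g]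
      simp only [sum_const_zero, mul_zero]
      linarith
    · have h1 : ∀ j, krylov B (i.val + 1) a j + (krylov B (i.val + 1) * B) a j =
          (krylov B i.val * B) a j := fun j =>
        congrFun (congrFun (krylov_succ_mul hB i.val) a) j
      have h4 : ∑ j, krylov B (i.val + 1) a j + ∑ j, (krylov B (i.val + 1) * B) a j =
          ∑ j, (krylov B i.val * B) a j := by
        rw [← sum_add_distrib, sum_congr rfl fun j _ => h1 j]
      simp only [PiLp.sub_apply, negShift_succ, y, hBg, Fin.val_succ, Fin.val_castSucc, g]
      linarith
  have hy0 : y 0 = WithLp.toLp 2 fun _ => 1 := by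
    ext i
    simp [y, hB _ _ (Fin.zero_le _)]
  have htraj : IsTrajectory H (negShift n) y := by
    rw [isTrajectory_iff]
    intro a
    simp only [hg, hy0]
    ext i
    simp [y, hBdef]
  have hzero : negShift n 0 = 0 := by
    ext i
    refine Fin.cases ?_ (fun i => ?_) i <;> simp
  have hrate := hH.2 _ (negShift n) (fun u v => (norm_negShift_sub u v).le) 0 hzero y htraj
  have hrow : ∀ i : Fin (n + 1), g (Fin.last n) i =
      2 / ((n : ℝ) + 1) * ∑ j, factor B (Fin.revPerm i) j := by
    intro i
    have hi : n - (Fin.revPerm i).val = i.val := by simp; omega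
    simp only [factor, hi, g, ← mul_sum]
    field_simp
  have hN : (0 : ℝ) < (n : ℝ) + 1 := by positivity
  rw [hg, hy0, EuclideanSpace.norm_sq_eq, sub_zero, EuclideanSpace.norm_sq_eq] at hrate
  simp only [hrow, Real.norm_eq_abs, sq_abs, mul_pow, ← mul_sum] at hrate
  rw [Equiv.sum_comp Fin.revPerm (fun r => (∑ j, factor B r j) ^ 2)] at hrate
  have hsq : ∑ r, (∑ j, factor B r j) ^ 2 ≤ (n : ℝ) + 1 := by
    simp only [one_pow, sum_const, card_univ, Fintype.card_fin, nsmul_eq_mul, mul_one] at hrate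
    push_cast at hrate
    field_simp at hrate
    linarith
  have hsum : ∑ r, ∑ j, factor B r j = (n : ℝ) + 1 := by
    rw [sum_comm (f := fun r j => factor B r j)]
    simp [sum_factor hB]
  -- equality in the Cauchy–Schwarz inequality: the row sums have variance zero
  have h0 : ∑ r, (∑ j, factor B r j - 1) ^ 2 ≤ 0 := by
    simp only [sub_sq, sum_add_distrib, sum_sub_distrib, mul_one, ← mul_sum, hsum]
    simp
    linarith
  have := (sum_eq_zero_iff_of_nonneg fun r _ => sq_nonneg (∑ j, factor B r j - 1)).1
    (le_antisymm h0 (sum_nonneg fun r _ => sq_nonneg _)) r (mem_univ r)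
  nlinarith [pow_eq_zero_iff (two_ne_zero) |>.1 this]

/-! ### Nonnegative certificates prove the optimal rate -/

section Rate

variable {X : Type} [NormedAddCommGroup X] [InnerProductSpace ℝ X]

open scoped InnerProductSpace

/-- The resolvent points `u - (u - T u) / 2` of a nonexpansive operator are monotone in the
displacements `u - T u`. -/
lemma inner_resolvent_nonneg {T : X → X} (hT : ∀ u v : X, ‖T u - T v‖ ≤ ‖u - v‖) (u v : X) :
    0 ≤ ⟪(u - (1 / 2 : ℝ) • (u - T u)) - (v - (1 / 2 : ℝ) • (v - T v)),
      (u - T u) - (v - T v)⟫_ℝ := by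
  have h1 : (u - (1 / 2 : ℝ) • (u - T u)) - (v - (1 / 2 : ℝ) • (v - T v)) =
      (1 / 2 : ℝ) • ((u - v) + (T u - T v)) := by module
  have h2 : (u - T u) - (v - T v) = (u - v) - (T u - T v) := by module
  have h3 := hT u v
  rw [h1, h2]
  generalize u - v = d at h3 ⊢
  generalize T u - T v = e at h3 ⊢
  rw [real_inner_smul_left, inner_add_left, inner_sub_right, inner_sub_right,
    real_inner_comm d e, real_inner_self_eq_norm_sq, real_inner_self_eq_norm_sq]
  nlinarith [norm_nonneg e]

/-- A weighted sum of monotonicity inequalities, with the weights `-G k j ≥ 0` read off from a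
symmetric matrix `G`. -/
lemma sum_inner_ge {G : Matrix (Fin (n + 1)) (Fin (n + 1)) ℝ} {c : ℝ}
    (hsymm : ∀ k j, G k j = G j k) (hneg : ∀ k j, j ≠ k → G k j ≤ 0)
    (hsum : ∀ k, ∑ j, G k j = if k = Fin.last n then c else 0) {x g : Fin (n + 1) → X}
    (hmono : ∀ k j, 0 ≤ ⟪x k - x j, g k - g j⟫_ℝ) :
    c * ⟪x (Fin.last n), g (Fin.last n)⟫_ℝ ≤ ∑ k, ∑ j, G k j * ⟪x k, g j⟫_ℝ := by
  have h1 : ∑ k, ∑ j, G k j * ⟪x k - x j, g k - g j⟫_ℝ ≤ 0 := by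
    refine sum_nonpos fun k _ => sum_nonpos fun j _ => ?_
    rcases eq_or_ne j k with rfl | hjk
    · simp
    · exact mul_nonpos_of_nonpos_of_nonneg (hneg k j hjk) (hmono k j)
  have h2 : ∑ k, ∑ j, G k j * ⟪x k, g k⟫_ℝ = c * ⟪x (Fin.last n), g (Fin.last n)⟫_ℝ := by
    simp only [← sum_mul, hsum, ite_mul, zero_mul, sum_ite_eq', mem_univ, if_true]
  have h3 : ∑ k, ∑ j, G k j * ⟪x j, g j⟫_ℝ = c * ⟪x (Fin.last n), g (Fin.last n)⟫_ℝ := by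
    rw [sum_comm, ← h2]
    exact sum_congr rfl fun k _ => sum_congr rfl fun j _ => by rw [hsymm]
  have h4 : ∑ k, ∑ j, G k j * ⟪x j, g k⟫_ℝ = ∑ k, ∑ j, G k j * ⟪x k, g j⟫_ℝ := by
    rw [sum_comm]
    exact sum_congr rfl fun k _ => sum_congr rfl fun j _ => by rw [hsymm]
  simp only [inner_sub_left, inner_sub_right, mul_sub, sum_sub_distrib] at h1
  linarith

lemma sum_inner_below (p : Fin (n + 1) → X) :
    ∑ r, ⟪(∑ s, belowDiag n r s • p s) + (1 / 2 : ℝ) • p r, p r⟫_ℝ =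
      1 / 2 * ‖∑ r, p r‖ ^ 2 := by
  have h1 : ‖∑ r, p r‖ ^ 2 = ∑ r, ∑ s, ⟪p s, p r⟫_ℝ := by
    rw [← real_inner_self_eq_norm_sq, sum_inner, sum_comm]
    exact sum_congr rfl fun r _ => by rw [inner_sum]
  have h2 : ∑ r, ∑ s, belowDiag n r s * ⟪p s, p r⟫_ℝ =
      ∑ r, ∑ s, belowDiag n s r * ⟪p s, p r⟫_ℝ := by
    rw [sum_comm]
    exact sum_congr rfl fun r _ => sum_congr rfl fun s _ => by rw [real_inner_comm]
  have h3 : ∑ r, ⟪p r, p r⟫_ℝ = ∑ r, ∑ s, (if s = r then 1 else 0) * ⟪p s, p r⟫_ℝ := by simp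
  have h4 : ∀ r s, ⟪p s, p r⟫_ℝ = belowDiag n r s * ⟪p s, p r⟫_ℝ +
      belowDiag n s r * ⟪p s, p r⟫_ℝ + (if s = r then 1 else 0) * ⟪p s, p r⟫_ℝ := by
    intro r s
    rw [← add_mul, ← add_mul]
    rcases lt_trichotomy r s with h | h | h
    · simp [belowDiag, h, h.not_gt, h.ne']
    · simp [belowDiag, h]
    · simp [belowDiag, h, h.not_gt, h.ne]
  rw [h1, sum_congr rfl fun r _ => sum_congr rfl fun s _ => h4 r s]
  simp only [sum_add_distrib, ← h2, ← h3, inner_add_left, sum_inner, real_inner_smul_left,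
    ← mul_sum]
  ring

/-- If the factor has row sums one and the certificates are nonnegative, the certificates are the
weights in a proof of the optimal rate. -/
lemma mem_optimalMatrices {H : Matrix (Fin n) (Fin n) ℝ}
    (hlow : ∀ k j : Fin n, k < j → H k j = 0) (hrow : ∀ r, ∑ j, factor (cumul H) r j = 1)
    (hcert : ∀ (k : Fin (n + 1)) (j : Fin n), j.castSucc < k → 0 ≤ cert H k j) :
    H ∈ optimalMatrices n := by
  refine ⟨hlow, ?_⟩
  intro X _ _ _ T hT yStar hstar y hy
  rw [isTrajectory_iff] at hy
  have hB : ∀ a b, a ≤ b → cumul H a b = 0 := fun a b => cumul_eq_zero H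
  set U := factor (cumul H) with hU
  set g : Fin (n + 1) → X := fun a => y a - T (y a) with hg
  set x : Fin (n + 1) → X := fun a => y a - (1 / 2 : ℝ) • g a with hx
  set p : Fin (n + 1) → X := fun r => ∑ j, U r j • g j with hp
  have hN : (0 : ℝ) < (n : ℝ) + 1 := by positivity
  have hsymm : ∀ k j, ∑ r, U r k * U r j = ∑ r, U r j * U r k := fun k j =>
    sum_congr rfl fun r _ => mul_comm _ _
  have hneg' : ∀ k j, j < k → ∑ r, U r k * U r j ≤ 0 := by
    intro k j hjk
    obtain ⟨j, rfl⟩ : ∃ j' : Fin n, j = j'.castSucc :=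
      ⟨j.castPred (hjk.trans_le (Fin.le_last k)).ne, by simp⟩
    have h1 := cert_eq H k j hjk
    have h2 := mul_nonneg hN.le (hcert k j hjk)
    linarith
  have key := sum_inner_ge (G := fun k j => ∑ r, U r k * U r j) (c := (n : ℝ) + 1) (x := x) (g := g)
    hsymm (fun k j hjk => by
      rcases lt_or_gt_of_ne hjk with h | h
      · exact hneg' k j h
      · rw [hsymm]; exact hneg' j k h)
    (fun k => by
      rw [sum_comm]
      simp only [← mul_sum, hrow, mul_one]
      exact sum_factor hB k)
    (fun k j => inner_resolvent_nonneg hT (y k) (y j))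
  have hps : ∑ r, p r = ((n : ℝ) + 1) • g (Fin.last n) := by
    rw [hp, sum_comm]
    simp only [← sum_smul, hU, sum_factor hB, ite_smul, zero_smul, sum_ite_eq', mem_univ, if_true]
  have hUx : ∀ r, ∑ k, U r k • x k =
      y 0 - ((∑ s, belowDiag n r s • p s) + (1 / 2 : ℝ) • p r) := by
    intro r
    have h1 : ∑ k, U r k • ∑ b, cumul H k b • g b = ∑ s, belowDiag n r s • p s := by
      have h2 : ∀ b, ∑ k, U r k * cumul H k b = ∑ s, belowDiag n r s * U s b := fun b =>
        congrFun (congrFun (factor_mul hB) r) b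
      simp only [hp, smul_sum, smul_smul]
      rw [sum_comm, sum_comm (f := fun s j => (belowDiag n r s * U s j) • g j)]
      simp only [← sum_smul, h2]
    have h3 : ∀ k, U r k • x k =
        U r k • y 0 - U r k • ∑ b, cumul H k b • g b - (1 / 2 : ℝ) • U r k • g k := by
      intro k
      simp only [hx]
      rw [hy k]
      module
    simp only [h3, sum_sub_distrib, ← sum_smul, h1, ← smul_sum, hrow, one_smul]
    abel
  have hsum : ∑ k, ∑ j, (∑ r, U r k * U r j) * ⟪x k, g j⟫_ℝ =
      ⟪y 0, ((n : ℝ) + 1) • g (Fin.last n)⟫_ℝ - 1 / 2 * ‖((n : ℝ) + 1) • g (Fin.last n)‖ ^ 2 := by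
    have h1 : ∑ k, ∑ j, (∑ r, U r k * U r j) * ⟪x k, g j⟫_ℝ =
        ∑ r, ⟪∑ k, U r k • x k, p r⟫_ℝ := by
      simp only [hp, sum_inner, inner_sum, real_inner_smul_left, real_inner_smul_right, sum_mul]
      rw [sum_congr rfl fun k _ => sum_comm, sum_comm]
      refine sum_congr rfl fun r _ => ?_
      rw [sum_comm]
      exact sum_congr rfl fun k _ => sum_congr rfl fun j _ => by ring
    rw [h1, ← hps, ← sum_inner_below, inner_sum, ← sum_sub_distrib]
    exact sum_congr rfl fun r _ => by rw [hUx, inner_sub_left]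
  rw [hsum, real_inner_smul_right, norm_smul, Real.norm_of_nonneg hN.le] at key
  have hfix := inner_resolvent_nonneg hT (y (Fin.last n)) yStar
  rw [hstar, sub_self, smul_zero, sub_zero, sub_zero] at hfix
  change 0 ≤ ⟪x (Fin.last n) - yStar, g (Fin.last n)⟫_ℝ at hfix
  rw [inner_sub_left] at hfix
  have hcs : ⟪y 0 - yStar, g (Fin.last n)⟫_ℝ ≤ ‖y 0 - yStar‖ * ‖g (Fin.last n)‖ :=
    real_inner_le_norm _ _
  rw [inner_sub_left] at hcs
  change ‖g (Fin.last n)‖ ^ 2 ≤ _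
  have hfin : ((n : ℝ) + 1) * ‖g (Fin.last n)‖ ^ 2 ≤ 2 * (‖y 0 - yStar‖ * ‖g (Fin.last n)‖) := by
    nlinarith
  have hle : ((n : ℝ) + 1) * ‖g (Fin.last n)‖ ≤ 2 * ‖y 0 - yStar‖ := by
    rcases (norm_nonneg (g (Fin.last n))).eq_or_lt with h | h
    · rw [← h]; simp
    · nlinarith
  rw [le_div_iff₀ (by positivity)]
  nlinarith [norm_nonneg (g (Fin.last n))]

end Rate

/-! ### Triangular structure of the factor -/

/-- The first row has a single entry, equal to its sum one, and `U r r = U (r+1) (r+1) * B (r+1) r`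
carries this down the diagonal. -/
lemma factor_diag_ne_zero {B : Matrix (Fin (n + 1)) (Fin (n + 1)) ℝ}
    (hB : ∀ a b, a ≤ b → B a b = 0) (hrow : ∀ r, ∑ j, factor B r j = 1) (r : Fin (n + 1)) :
    factor B r r ≠ 0 := by
  refine Fin.induction ?_ (fun r ih => ?_) r
  · have h := hrow 0
    rw [sum_eq_single 0 (fun j _ hj => factor_eq_zero hB (Fin.pos_of_ne_zero hj)) (by simp)] at h
    simp [h]
  · intro h
    apply ih
    have h1 : (factor B * B) r.castSucc r.castSucc = 0 := by
      rw [mul_apply]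
      refine sum_eq_zero fun c _ => ?_
      rcases le_or_gt c r.castSucc with hc | hc
      · rw [hB _ _ hc, mul_zero]
      · rw [factor_eq_zero hB hc, zero_mul]
    have h2 : (factor B * B) r.succ r.castSucc = 0 := by
      rw [mul_apply]
      refine sum_eq_zero fun c _ => ?_
      rcases le_or_gt c r.castSucc with hc | hc
      · rw [hB _ _ hc, mul_zero]
      · rcases (Fin.castSucc_lt_iff_succ_le.1 hc).eq_or_lt with rfl | hc'
        · rw [h, zero_mul]
        · rw [factor_eq_zero hB hc', zero_mul]
    have h3 := factor_castSucc hB r r.castSucc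
    rwa [h1, h2, add_zero] at h3

/-- Each column of the factor but the last has sum zero, so it cannot be orthogonal to all later
ones. -/
lemma exists_cert_ne_zero {H : Matrix (Fin n) (Fin n) ℝ} (hH : H ∈ optimalMatrices n)
    (j : Fin n) : ∃ k, j.castSucc < k ∧ cert H k j ≠ 0 := by
  by_contra! hcon
  have hB : ∀ a b, a ≤ b → cumul H a b = 0 := fun a b => cumul_eq_zero H
  have hdiag := factor_diag_ne_zero hB (sum_factor_row_of_optimal hH)
  -- the column `j` is orthogonal to all later columns, so it is supported on its diagonal entry
  have hzero : ∀ k, j.castSucc < k → factor (cumul H) k j.castSucc = 0 := by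
    intro k
    induction k using WellFoundedGT.induction with
    | ind k ih =>
      intro hk
      have h1 := cert_eq H k j hk
      rw [hcon k hk, mul_zero, eq_comm, neg_eq_zero, sum_eq_single k] at h1
      · exact (mul_eq_zero.1 h1).resolve_left (hdiag k)
      · intro r _ hrk
        rcases lt_or_gt_of_ne hrk with h | h
        · rw [factor_eq_zero hB h, zero_mul]
        · rw [ih r h (hk.trans h), mul_zero]
      · simp
  have h1 := sum_factor hB j.castSucc
  rw [if_neg (Fin.castSucc_lt_last j).ne, sum_eq_single j.castSucc] at h1
  · exact hdiag _ h1
  · intro r _ hr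
    rcases lt_or_gt_of_ne hr with h | h
    · exact factor_eq_zero hB h
    · exact hzero r h
  · simp

lemma lowerTriangular_inv {U : Matrix (Fin (n + 1)) (Fin (n + 1)) ℝ}
    (hU : ∀ r j, r < j → U r j = 0) (hdiag : ∀ r, U r r ≠ 0) :
    IsUnit U.det ∧ ∀ r j, r < j → U⁻¹ r j = 0 := by
  have hT : U.BlockTriangular OrderDual.toDual := fun r j h => hU r j h
  have hdet : IsUnit U.det := by
    rw [det_of_isLowerTriangular U hT, isUnit_iff_ne_zero]
    exact prod_ne_zero_iff.2 fun r _ => hdiag r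
  let := U.invertibleOfIsUnitDet hdet
  exact ⟨hdet, fun r j h => blockTriangular_inv_of_blockTriangular hT h⟩

lemma mul_lower_apply_eq_zero {A C : Matrix (Fin (n + 1)) (Fin (n + 1)) ℝ}
    (hA : ∀ a b, a < b → A a b = 0) (hC : ∀ a b, a ≤ b → C a b = 0) {a b : Fin (n + 1)}
    (hab : a ≤ b) : (A * C) a b = 0 := by
  rw [mul_apply]
  refine sum_eq_zero fun c _ => ?_
  rcases le_or_gt c b with h | h
  · rw [hC c b h, mul_zero]
  · rw [hA a c (hab.trans_lt h), zero_mul]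

lemma mul_lower_apply_eq_zero' {A C : Matrix (Fin (n + 1)) (Fin (n + 1)) ℝ}
    (hA : ∀ a b, a ≤ b → A a b = 0) (hC : ∀ a b, a < b → C a b = 0) {a b : Fin (n + 1)}
    (hab : a ≤ b) : (A * C) a b = 0 := by
  rw [mul_apply]
  refine sum_eq_zero fun c _ => ?_
  rcases lt_or_ge c b with h | h
  · rw [hC c b h, mul_zero]
  · rw [hA a c (hab.trans h), zero_mul]

lemma belowDiag_add_transpose : belowDiag n + (belowDiag n)ᵀ + 1 = of fun _ _ => 1 := by
  ext r s
  rcases lt_trichotomy r s with h | h | h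
  · simp [belowDiag, h, h.not_gt, h.ne, Matrix.add_apply]
  · simp [belowDiag, h, Matrix.add_apply]
  · simp [belowDiag, h, h.not_gt, h.ne', Matrix.add_apply]

/-- The Lyapunov equation satisfied by the Gram matrix of the factor; its right-hand side does not
depend on `B`. -/
lemma lyapunov {B : Matrix (Fin (n + 1)) (Fin (n + 1)) ℝ} (hB : ∀ a b, a ≤ b → B a b = 0) :
    (factor B)ᵀ * factor B * B + Bᵀ * ((factor B)ᵀ * factor B) + (factor B)ᵀ * factor B =
      of fun k j => (if k = Fin.last n then (n : ℝ) + 1 else 0) *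
        (if j = Fin.last n then (n : ℝ) + 1 else 0) := by
  have h1 : (factor B)ᵀ * factor B * B + Bᵀ * ((factor B)ᵀ * factor B) + (factor B)ᵀ * factor B =
      (factor B)ᵀ * (belowDiag n + (belowDiag n)ᵀ + 1) * factor B := by
    rw [← Matrix.mul_assoc Bᵀ, ← transpose_mul, Matrix.mul_assoc _ _ B, factor_mul hB,
      transpose_mul, Matrix.mul_add, Matrix.mul_add, Matrix.add_mul, Matrix.add_mul,
      Matrix.mul_one, Matrix.mul_assoc, Matrix.mul_assoc]
  rw [h1, belowDiag_add_transpose]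
  ext k j
  rw [Matrix.mul_apply]
  simp only [Matrix.mul_apply, transpose_apply, of_apply, mul_one, sum_factor hB, ← mul_sum]

/-- Subtracting the Lyapunov equations of `B` and `B'` shows that `U * (B - B') * U⁻¹` is
skew-symmetric; it is also strictly lower triangular. -/
lemma eq_of_gram_eq {B B' : Matrix (Fin (n + 1)) (Fin (n + 1)) ℝ}
    (hB : ∀ a b, a ≤ b → B a b = 0) (hB' : ∀ a b, a ≤ b → B' a b = 0)
    (hdiag : ∀ r, factor B r r ≠ 0)
    (h : (factor B)ᵀ * factor B = (factor B')ᵀ * factor B') : B = B' := by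
  obtain ⟨hdet, hinv⟩ := lowerTriangular_inv (fun r j => factor_eq_zero hB) hdiag
  set U := factor B with hU
  have e1 := lyapunov hB
  have e2 := lyapunov hB'
  rw [← hU] at e1
  rw [← h, ← e1] at e2
  have e3 : Uᵀ * U * (B - B') + (B - B')ᵀ * (Uᵀ * U) = 0 := by
    rw [Matrix.mul_sub, transpose_sub, Matrix.sub_mul]
    have := sub_eq_zero.2 e2
    rw [← neg_eq_zero, ← this]
    abel
  have e4 : U * (B - B') * U⁻¹ + (U * (B - B') * U⁻¹)ᵀ = 0 := by
    have hUt : U⁻¹ᵀ * Uᵀ = 1 := by rw [← transpose_mul, mul_nonsing_inv _ hdet, transpose_one]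
    have hUi : U * U⁻¹ = 1 := mul_nonsing_inv _ hdet
    calc U * (B - B') * U⁻¹ + (U * (B - B') * U⁻¹)ᵀ
        = (U⁻¹ᵀ * Uᵀ) * U * (B - B') * U⁻¹ + U⁻¹ᵀ * (B - B')ᵀ * Uᵀ * (U * U⁻¹) := by
          rw [hUt, hUi, Matrix.one_mul, Matrix.mul_one, transpose_mul, transpose_mul,
            Matrix.mul_assoc]
          simp only [Matrix.mul_assoc]
      _ = U⁻¹ᵀ * (Uᵀ * U * (B - B') + (B - B')ᵀ * (Uᵀ * U)) * U⁻¹ := by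
          simp only [Matrix.mul_assoc, Matrix.mul_add, Matrix.add_mul]
      _ = 0 := by rw [e3, Matrix.mul_zero, Matrix.zero_mul]
  have hlow : ∀ a b, a ≤ b → (U * (B - B') * U⁻¹) a b = 0 := by
    intro a b hab
    refine mul_lower_apply_eq_zero' (fun a b hab => ?_) hinv hab
    refine mul_lower_apply_eq_zero (fun r j => factor_eq_zero hB) (fun a b hab => ?_) hab
    rw [Matrix.sub_apply, hB a b hab, hB' a b hab, sub_zero]
  have e5 : U * (B - B') * U⁻¹ = 0 := by
    ext a b
    rcases le_total a b with hab | hab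
    · exact hlow a b hab
    · have h6 := congrFun (congrFun e4 a) b
      rw [Matrix.add_apply, transpose_apply, hlow b a hab, add_zero] at h6
      exact h6
  have e6 : U⁻¹ * (U * (B - B') * U⁻¹) * U = B - B' := by
    rw [Matrix.mul_assoc, Matrix.mul_assoc _ U⁻¹, nonsing_inv_mul _ hdet, Matrix.mul_one,
      ← Matrix.mul_assoc, nonsing_inv_mul _ hdet, Matrix.one_mul]
  rw [e5, Matrix.mul_zero, Matrix.zero_mul] at e6
  exact sub_eq_zero.1 e6.symm

/-! ### Rooted trees -/

/-- `Desc k a b`: the node `a` lies in the subtree below `b`, in the tree where the parent of `j` is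
`k j` and the root is the last node. -/
def Desc (k : Fin n → Fin (n + 1)) : Fin (n + 1) → Fin (n + 1) → Prop :=
  Relation.ReflTransGen fun x y => ∃ j : Fin n, x = j.castSucc ∧ y = k j

section Tree

variable {k : Fin n → Fin (n + 1)}

lemma Desc.refl (a : Fin (n + 1)) : Desc k a a := Relation.ReflTransGen.refl

lemma Desc.parent {a : Fin (n + 1)} {c : Fin n} (h : Desc k a c.castSucc) : Desc k a (k c) :=
  Relation.ReflTransGen.tail h ⟨c, rfl, rfl⟩

lemma desc_castSucc_iff {j : Fin n} {b : Fin (n + 1)} :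
    Desc k j.castSucc b ↔ b = j.castSucc ∨ Desc k (k j) b := by
  unfold Desc
  rw [Relation.ReflTransGen.cases_head_iff]
  constructor
  · rintro (h | ⟨c, ⟨i, hi, rfl⟩, h⟩)
    · exact Or.inl h.symm
    · rw [Fin.castSucc_injective _ hi]
      exact Or.inr h
  · rintro (h | h)
    · exact Or.inl h.symm
    · exact Or.inr ⟨_, ⟨j, rfl, rfl⟩, h⟩

variable (hk : ∀ j : Fin n, j.castSucc < k j)
include hk

lemma Desc.le {a b : Fin (n + 1)} (h : Desc k a b) : a ≤ b := by
  induction h with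
  | refl => exact le_rfl
  | tail _ h ih =>
    obtain ⟨j, rfl, rfl⟩ := h
    exact ih.trans (hk j).le

lemma desc_last (a : Fin (n + 1)) : Desc k a (Fin.last n) := by
  induction a using WellFoundedGT.induction with
  | ind a ih =>
    obtain ⟨j, rfl⟩ | rfl := a.eq_castSucc_or_eq_last
    · exact desc_castSucc_iff.2 (Or.inr (ih _ (hk j)))
    · exact Desc.refl _

lemma not_desc_parent (j : Fin n) : ¬ Desc k (k j) j.castSucc :=
  fun h => ((h.le hk).trans_lt (hk j)).false

/-- A proper descendant of `p` lies below exactly one child of `p`. -/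
lemma existsUnique_child {a p : Fin (n + 1)} (hap : a ≠ p) (h : Desc k a p) :
    ∃! c : Fin n, k c = p ∧ Desc k a c.castSucc := by
  obtain h | ⟨_, hac, c, rfl, rfl⟩ := Relation.ReflTransGen.cases_tail h
  · exact absurd h.symm hap
  · refine ⟨c, ⟨rfl, hac⟩, ?_⟩
    rintro d ⟨hd, hd'⟩
    have key : ∀ {c d : Fin n}, k d = k c → Desc k c.castSucc d.castSucc → d = c := by
      intro c d hdc hcd
      rcases desc_castSucc_iff.1 hcd with h | h
      · exact Fin.castSucc_injective _ h
      · rw [← hdc] at h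
        exact absurd h (not_desc_parent hk d)
    have hru : Relator.RightUnique fun x y => ∃ j : Fin n, x = j.castSucc ∧ y = k j := by
      rintro x y z ⟨i, rfl, rfl⟩ ⟨j, hj, rfl⟩
      rw [Fin.castSucc_injective _ hj]
    rcases Relation.ReflTransGen.total_of_right_unique hru hac hd' with h1 | h1
    · exact key hd h1
    · exact (key hd.symm h1).symm

end Tree

/-! ### The weighted Laplacian of a rooted tree -/

/-- The incidence vector `e_c - e_{k c}` of the edge from `c` to its parent. -/
def edgeVec (k : Fin n → Fin (n + 1)) (c : Fin n) (a : Fin (n + 1)) : ℝ :=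
  (if a = c.castSucc then 1 else 0) - (if a = k c then 1 else 0)

/-- The Laplacian of the tree with edge weights `w`, plus one in the diagonal entry of the root. -/
def treeLap (k : Fin n → Fin (n + 1)) (w : Fin n → ℝ) : Matrix (Fin (n + 1)) (Fin (n + 1)) ℝ :=
  fun a b => ∑ c, w c * edgeVec k c a * edgeVec k c b +
    (if a = Fin.last n then 1 else 0) * (if b = Fin.last n then 1 else 0)

/-- The flow into `p` from its children, when the potentials are `v` and the conductances `w`. -/
def inflow (k : Fin n → Fin (n + 1)) (w : Fin n → ℝ) (v : Fin (n + 1) → ℝ) (p : Fin (n + 1)) : ℝ :=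
  ∑ c, if k c = p then w c * (v p - v c.castSucc) else 0

lemma treeLap_symm (k : Fin n → Fin (n + 1)) (w : Fin n → ℝ) (a b : Fin (n + 1)) :
    treeLap k w a b = treeLap k w b a := by
  unfold treeLap
  congr 1
  · exact sum_congr rfl fun c _ => by ring
  · ring

lemma sum_edgeVec_mul (k : Fin n → Fin (n + 1)) (c : Fin n) (v : Fin (n + 1) → ℝ) :
    ∑ b, edgeVec k c b * v b = v c.castSucc - v (k c) := by
  simp [edgeVec, sub_mul, sum_sub_distrib]

lemma treeLap_mulVec (k : Fin n → Fin (n + 1)) (w : Fin n → ℝ) (v : Fin (n + 1) → ℝ)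
    (a : Fin (n + 1)) : (treeLap k w *ᵥ v) a =
      ∑ c, w c * edgeVec k c a * (v c.castSucc - v (k c)) +
        if a = Fin.last n then v (Fin.last n) else 0 := by
  simp only [mulVec, dotProduct, treeLap, add_mul, sum_add_distrib, sum_mul]
  rw [sum_comm]
  congr 1
  · refine sum_congr rfl fun c _ => ?_
    rw [← sum_edgeVec_mul, mul_sum]
    exact sum_congr rfl fun b _ => by ring
  · simp

lemma treeLap_mulVec_castSucc (k : Fin n → Fin (n + 1)) (w : Fin n → ℝ) (v : Fin (n + 1) → ℝ)
    (p : Fin n) : (treeLap k w *ᵥ v) p.castSucc =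
      inflow k w v p.castSucc - w p * (v (k p) - v p.castSucc) := by
  have h : w p * (v (k p) - v p.castSucc) =
      ∑ c, if p = c then w c * (v (k c) - v c.castSucc) else 0 := by simp
  rw [treeLap_mulVec, if_neg (Fin.castSucc_lt_last p).ne, add_zero, inflow, h, ← sum_sub_distrib]
  refine sum_congr rfl fun c _ => ?_
  by_cases h1 : k c = p.castSucc
  · rw [if_pos h1]
    simp only [edgeVec, h1, Fin.castSucc_inj]
    split_ifs <;> ring
  · rw [if_neg h1]
    simp only [edgeVec, Ne.symm h1, if_false, Fin.castSucc_inj]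
    split_ifs <;> ring

lemma treeLap_mulVec_last (k : Fin n → Fin (n + 1)) (w : Fin n → ℝ) (v : Fin (n + 1) → ℝ) :
    (treeLap k w *ᵥ v) (Fin.last n) = inflow k w v (Fin.last n) + v (Fin.last n) := by
  rw [treeLap_mulVec, if_pos rfl, inflow]
  congr 1
  refine sum_congr rfl fun c _ => ?_
  simp only [edgeVec, (Fin.castSucc_lt_last c).ne', if_false, eq_comm (a := Fin.last n)]
  split_ifs with h
  · rw [h]; ring
  · ring

lemma treeLap_apply_of_lt {k : Fin n → Fin (n + 1)} (hk : ∀ j : Fin n, j.castSucc < k j)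
    (w : Fin n → ℝ) {a : Fin (n + 1)} {j : Fin n} (h : j.castSucc < a) :
    treeLap k w a j.castSucc = if k j = a then -w j else 0 := by
  rw [treeLap, if_neg (Fin.castSucc_lt_last j).ne, mul_zero, add_zero, sum_eq_single j]
  · simp only [edgeVec, h.ne', if_false, (hk j).ne, if_true, eq_comm (a := a)]
    split_ifs <;> ring
  · intro c _ hc
    simp only [edgeVec, Fin.castSucc_inj, hc.symm, if_false]
    by_cases h1 : j.castSucc = k c
    · have h2 : a ≠ c.castSucc := fun h2 => by
        have := hk c
        rw [← h1, ← h2] at this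
        exact (this.trans h).false
      simp only [h1, if_true, h2, if_false]
      rw [if_neg (h1 ▸ h.ne')]
      ring
    · simp [h1]
  · simp

lemma sum_treeLap (k : Fin n → Fin (n + 1)) (w : Fin n → ℝ) (a : Fin (n + 1)) :
    ∑ b, treeLap k w a b = if a = Fin.last n then 1 else 0 := by
  have h := treeLap_mulVec k w (fun _ => 1) a
  simpa [mulVec, dotProduct] using h

/-- A symmetric matrix is determined by its entries below the diagonal and its row sums. -/
lemma eq_treeLap {k : Fin n → Fin (n + 1)} (hk : ∀ j : Fin n, j.castSucc < k j)
    {w : Fin n → ℝ} {G : Matrix (Fin (n + 1)) (Fin (n + 1)) ℝ} (hsymm : ∀ a b, G a b = G b a)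
    (hsum : ∀ a, ∑ b, G a b = if a = Fin.last n then 1 else 0)
    (hG : ∀ (a : Fin (n + 1)) (j : Fin n), j.castSucc < a →
      G a j.castSucc = if k j = a then -w j else 0) : G = treeLap k w := by
  have hlt : ∀ a b, b < a → G a b = treeLap k w a b := by
    intro a b hba
    obtain ⟨j, rfl⟩ | rfl := b.eq_castSucc_or_eq_last
    · rw [hG a j hba, treeLap_apply_of_lt hk w hba]
    · exact absurd hba (Fin.le_last a).not_gt
  have hne : ∀ a b, b ≠ a → G a b = treeLap k w a b := by
    intro a b hba
    rcases lt_or_gt_of_ne hba with h | h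
    · exact hlt a b h
    · rw [hsymm, treeLap_symm, hlt b a h]
  ext a b
  rcases eq_or_ne b a with rfl | h
  · have h1 := (hsum b).trans (sum_treeLap k w b).symm
    rw [← add_sum_erase _ _ (mem_univ b),
      ← add_sum_erase _ (fun c => treeLap k w b c) (mem_univ b),
      sum_congr rfl fun c hc => hne b c (ne_of_mem_erase hc)] at h1
    exact add_right_cancel h1
  · exact hne a b h

/-- The energy of the indicator of a subtree is the weight of the edge above it. -/
lemma energy_subtree {k : Fin n → Fin (n + 1)} (hk : ∀ j : Fin n, j.castSucc < k j)
    (w : Fin n → ℝ) (j : Fin n) [DecidablePred fun a => Desc k a j.castSucc] :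
    (fun a => if Desc k a j.castSucc then (1 : ℝ) else 0) ⬝ᵥ
      (treeLap k w *ᵥ fun a => if Desc k a j.castSucc then (1 : ℝ) else 0) = w j := by
  set x : Fin (n + 1) → ℝ := fun a => if Desc k a j.castSucc then 1 else 0 with hx
  have hlast : x (Fin.last n) = 0 :=
    if_neg fun h => (h.le hk).not_gt (Fin.castSucc_lt_last j)
  simp only [dotProduct, treeLap_mulVec, hlast, ite_self, add_zero, mul_sum]
  rw [sum_comm, sum_eq_single j]
  · have h1 : x j.castSucc - x (k j) = 1 := by
      simp [hx, Desc.refl, not_desc_parent hk j]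
    rw [h1]
    calc ∑ a, x a * (w j * edgeVec k j a * 1) = w j * ∑ a, edgeVec k j a * x a := by
          rw [mul_sum]; exact sum_congr rfl fun a _ => by ring
      _ = w j := by rw [sum_edgeVec_mul, h1, mul_one]
  · intro c _ hc
    have h1 : x c.castSucc = x (k c) := by
      simp [hx, desc_castSucc_iff (j := c), Fin.castSucc_inj, hc.symm]
    rw [h1]
    simp
  · simp

/-! ### Effective conductances -/

/-- The conductance from the parent of `c` through the edge `c` to the grounded nodes `0, …, t - 1`
of the subtree below `c`, for the edge conductances `w`. -/
noncomputable def edgeCond (k : Fin n → Fin (n + 1)) (hk : ∀ j : Fin n, j.castSucc < k j)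
    (w : Fin n → ℝ) (t : ℕ) (c : Fin n) : ℝ :=
  if c.val < t then w c else
    w c * (∑ d : Fin n, if _h : k d = c.castSucc then edgeCond k hk w t d else 0) /
      (w c + ∑ d : Fin n, if _h : k d = c.castSucc then edgeCond k hk w t d else 0)
termination_by c.val
decreasing_by all_goals exact Fin.castSucc_lt_castSucc_iff.1 (_h ▸ hk d)

/-- The conductance from `p` down to the grounded nodes `0, …, t - 1`. -/
noncomputable def nodeCond (k : Fin n → Fin (n + 1)) (hk : ∀ j : Fin n, j.castSucc < k j)
    (w : Fin n → ℝ) (t : ℕ) (p : Fin (n + 1)) : ℝ :=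
  ∑ d, if k d = p then edgeCond k hk w t d else 0

section Conductance

variable {k : Fin n → Fin (n + 1)} {hk : ∀ j : Fin n, j.castSucc < k j} {w w' : Fin n → ℝ}

lemma edgeCond_of_lt {t : ℕ} {c : Fin n} (h : c.val < t) : edgeCond k hk w t c = w c := by
  rw [edgeCond, if_pos h]

lemma edgeCond_of_ge {t : ℕ} {c : Fin n} (h : t ≤ c.val) : edgeCond k hk w t c =
    w c * nodeCond k hk w t c.castSucc / (w c + nodeCond k hk w t c.castSucc) := by
  rw [edgeCond, if_neg h.not_gt]
  rfl

lemma edgeCond_nonneg (hw : ∀ c, 0 < w c) (t : ℕ) (c : Fin n) : 0 ≤ edgeCond k hk w t c := by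
  induction c using WellFoundedLT.induction with
  | ind c ih =>
    rcases lt_or_ge c.val t with h | h
    · rw [edgeCond_of_lt h]
      exact (hw c).le
    · rw [edgeCond_of_ge h]
      have h1 : 0 ≤ nodeCond k hk w t c.castSucc := by
        refine sum_nonneg fun d _ => ?_
        split_ifs with hd
        · exact ih d (Fin.castSucc_lt_castSucc_iff.1 (hd ▸ hk d))
        · exact le_rfl
      have := hw c
      positivity

lemma nodeCond_nonneg (hw : ∀ c, 0 < w c) (t : ℕ) (p : Fin (n + 1)) : 0 ≤ nodeCond k hk w t p := by
  refine sum_nonneg fun d _ => ?_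
  split_ifs
  · exact edgeCond_nonneg hw t d
  · exact le_rfl

lemma edgeCond_zero (c : Fin n) : edgeCond k hk w 0 c = 0 := by
  induction c using WellFoundedLT.induction with
  | ind c ih =>
    have h1 : nodeCond k hk w 0 c.castSucc = 0 := by
      refine sum_eq_zero fun d _ => ?_
      split_ifs with hd
      · exact ih d (Fin.castSucc_lt_castSucc_iff.1 (hd ▸ hk d))
      · rfl
    rw [edgeCond_of_ge (Nat.zero_le _), h1, mul_zero, zero_div]

/-- Grounding a node outside of the subtree below `c` does not change the conductance of `c`. -/
lemma edgeCond_succ_of_not_desc {i c : Fin n} (h : ¬ Desc k i.castSucc c.castSucc) :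
    edgeCond k hk w (i.val + 1) c = edgeCond k hk w i.val c := by
  induction c using WellFoundedLT.induction with
  | ind c ih =>
    have hic : i.val ≠ c.val := fun hic => h (by rw [Fin.ext hic]; exact Desc.refl _)
    rcases lt_or_ge c.val i.val with hc | hc
    · rw [edgeCond_of_lt hc, edgeCond_of_lt (by omega)]
    · have h1 : nodeCond k hk w (i.val + 1) c.castSucc = nodeCond k hk w i.val c.castSucc := by
        refine sum_congr rfl fun d _ => ?_
        split_ifs with hd
        · exact ih d (Fin.castSucc_lt_castSucc_iff.1 (hd ▸ hk d)) fun h' => h (hd ▸ h'.parent)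
        · rfl
      rw [edgeCond_of_ge hc, edgeCond_of_ge (by omega), h1]

/-- Grounding a node below `c` changes the conductances of `c` and of its parent by the same
amount. -/
lemma edgeCond_succ_sub {i c : Fin n} (h : Desc k i.castSucc c.castSucc) :
    edgeCond k hk w (i.val + 1) c - edgeCond k hk w i.val c =
      nodeCond k hk w (i.val + 1) (k c) - nodeCond k hk w i.val (k c) := by
  rw [nodeCond, nodeCond, ← sum_sub_distrib, sum_eq_single c]
  · simp
  · intro d _ hd
    split_ifs with hdc
    · rw [edgeCond_succ_of_not_desc, sub_self]
      intro h'
      have hne : i.castSucc ≠ k c := ((h.le hk).trans_lt (hk c)).ne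
      exact hd ((existsUnique_child hk hne h.parent).unique ⟨hdc, h'⟩ ⟨rfl, h⟩)
    · rw [sub_self]
  · simp

/-- The increments of the conductance of `p` are those of the child edge below which the newly
grounded node lies, so the conductance of `p` determines those of its child edges. -/
lemma edgeCond_congr {c : Fin n}
    (h : ∀ t ≤ (k c).val, nodeCond k hk w t (k c) = nodeCond k hk w' t (k c)) (t : ℕ)
    (ht : t ≤ (k c).val) : edgeCond k hk w t c = edgeCond k hk w' t c := by
  induction t with
  | zero => rw [edgeCond_zero, edgeCond_zero]
  | succ t ih =>
    have ih := ih (by omega)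
    have htn : t < n := by have := (k c).isLt; omega
    by_cases hd : Desc k (Fin.castSucc ⟨t, htn⟩) c.castSucc
    · have h1 := edgeCond_succ_sub (hk := hk) (w := w) hd
      have h2 := edgeCond_succ_sub (hk := hk) (w := w') hd
      simp only [h (t + 1) ht, h t (by omega), ih] at h1 h2
      linarith
    · have h1 := edgeCond_succ_of_not_desc (hk := hk) (w := w) hd
      have h2 := edgeCond_succ_of_not_desc (hk := hk) (w := w') hd
      simp only at h1 h2
      rw [h1, h2, ih]

/-- The edge conductances are determined by the conductances from the root to the sets of grounded
nodes `0, …, t - 1`. -/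
lemma eq_of_nodeCond_last_eq (hw : ∀ c, 0 < w c) (hw' : ∀ c, 0 < w' c)
    (h : ∀ t ≤ n, nodeCond k hk w t (Fin.last n) = nodeCond k hk w' t (Fin.last n)) : w = w' := by
  have hnode : ∀ (p : Fin (n + 1)), ∀ t ≤ p.val, nodeCond k hk w t p = nodeCond k hk w' t p := by
    intro p
    induction p using WellFoundedGT.induction with
    | ind p ih =>
      obtain ⟨c, rfl⟩ | rfl := p.eq_castSucc_or_eq_last
      · intro t ht
        rw [Fin.val_castSucc] at ht
        have hc := hk c
        have hc' : c.val < (k c).val := by simpa [Fin.lt_def] using hc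
        have he := edgeCond_congr (ih _ hc)
        have hwc : w c = w' c := by
          have h1 := he (c.val + 1) hc'
          rwa [edgeCond_of_lt (by omega), edgeCond_of_lt (by omega)] at h1
        have h1 := he t (by omega)
        rw [edgeCond_of_ge ht, edgeCond_of_ge ht, ← hwc] at h1
        have h2 := nodeCond_nonneg (hk := hk) hw t c.castSucc
        have h3 := nodeCond_nonneg (hk := hk) hw' t c.castSucc
        have h4 := hw c
        rw [div_eq_div_iff (by positivity) (by positivity)] at h1
        have h5 : w c ^ 2 * (nodeCond k hk w t c.castSucc - nodeCond k hk w' t c.castSucc) = 0 := by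
          linear_combination h1
        exact sub_eq_zero.1 ((mul_eq_zero.1 h5).resolve_left (by positivity))
      · exact h
  funext c
  have h1 := edgeCond_congr (hnode (k c)) (c.val + 1) (by simpa [Fin.lt_def] using hk c)
  rwa [edgeCond_of_lt (by omega), edgeCond_of_lt (by omega)] at h1

/-- Ohm's law for a potential that vanishes on the grounded nodes and is harmonic at the others. -/
lemma flow_eq (hw : ∀ c, 0 < w c) {t : ℕ} {v : Fin (n + 1) → ℝ}
    (hground : ∀ c : Fin n, c.val < t → v c.castSucc = 0)
    (hharm : ∀ c : Fin n, t ≤ c.val →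
      inflow k w v c.castSucc = w c * (v (k c) - v c.castSucc)) (c : Fin n) :
    w c * (v (k c) - v c.castSucc) = edgeCond k hk w t c * v (k c) := by
  induction c using WellFoundedLT.induction with
  | ind c ih =>
    rcases lt_or_ge c.val t with h | h
    · rw [edgeCond_of_lt h, hground c h, sub_zero]
    · have h1 : inflow k w v c.castSucc = nodeCond k hk w t c.castSucc * v c.castSucc := by
        rw [inflow, nodeCond, sum_mul]
        refine sum_congr rfl fun d _ => ?_
        split_ifs with hd
        · rw [← hd]
          exact ih d (Fin.castSucc_lt_castSucc_iff.1 (hd ▸ hk d))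
        · rw [zero_mul]
      have h2 := hharm c h
      have h3 := nodeCond_nonneg (hk := hk) hw t c.castSucc
      have h4 := hw c
      have h5 : v c.castSucc = w c * v (k c) / (w c + nodeCond k hk w t c.castSucc) := by
        rw [eq_div_iff (by positivity)]
        linarith
      rw [← h2, h1, h5, edgeCond_of_ge h]
      ring

lemma nodeCond_last_mul (hw : ∀ c, 0 < w c) {t : ℕ} {v : Fin (n + 1) → ℝ}
    (hground : ∀ c : Fin n, c.val < t → v c.castSucc = 0)
    (hharm : ∀ c : Fin n, t ≤ c.val → (treeLap k w *ᵥ v) c.castSucc = 0) :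
    nodeCond k hk w t (Fin.last n) * v (Fin.last n) + v (Fin.last n) =
      (treeLap k w *ᵥ v) (Fin.last n) := by
  have hharm' : ∀ c : Fin n, t ≤ c.val →
      inflow k w v c.castSucc = w c * (v (k c) - v c.castSucc) := by
    intro c hc
    have := hharm c hc
    rw [treeLap_mulVec_castSucc] at this
    linarith
  rw [treeLap_mulVec_last, inflow, nodeCond, sum_mul]
  congr 1
  refine sum_congr rfl fun c _ => ?_
  split_ifs with h
  · rw [← h]
    exact (flow_eq hw hground hharm' c).symm
  · rw [zero_mul]

end Conductance

/-! ### Edge weights with prescribed root conductances -/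

open scoped Classical in
/-- The conductances `t ↦ C p t` from `p` to the grounded nodes `0, …, t - 1` that are forced, from
the root downwards, by the value `t / (N - t)` at the root. A child `c` of `p` receives the
increments of `C p` at the nodes below `c`; this is the series connection of its edge, which has the
final conductance, and `C c`. -/
noncomputable def targetNode (k : Fin n → Fin (n + 1)) (hk : ∀ j : Fin n, j.castSucc < k j)
    (p : Fin (n + 1)) : ℕ → ℝ :=
  if h : p.val < n then
    let f : ℕ → ℝ := fun t => ∑ i : Fin n, if i.val < t ∧ Desc k i.castSucc p then
      targetNode k hk (k ⟨p.val, h⟩) (i.val + 1) - targetNode k hk (k ⟨p.val, h⟩) i.val else 0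
    fun t => f t * f (p.val + 1) / (f (p.val + 1) - f t)
  else fun t => t / ((n : ℝ) + 1 - t)
termination_by n - p.val
decreasing_by
  all_goals
    have := hk ⟨p.val, h⟩
    rw [Fin.lt_def] at this
    simp only [Fin.val_castSucc] at this
    omega

open scoped Classical in
/-- The conductance through the edge `c` that is forced by the value `t / (N - t)` at the root. -/
noncomputable def targetEdge (k : Fin n → Fin (n + 1)) (hk : ∀ j : Fin n, j.castSucc < k j)
    (c : Fin n) (t : ℕ) : ℝ :=
  ∑ i : Fin n, if i.val < t ∧ Desc k i.castSucc c.castSucc then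
    targetNode k hk (k c) (i.val + 1) - targetNode k hk (k c) i.val else 0

/-- The weight of the edge `c` that is forced by the conductance `t / (N - t)` at the root. -/
noncomputable def targetWeight (k : Fin n → Fin (n + 1)) (hk : ∀ j : Fin n, j.castSucc < k j)
    (c : Fin n) : ℝ :=
  targetEdge k hk c (c.val + 1)

/-- The potential of the node `p` when `0, …, t - 1` are grounded and the root has potential
`N - t`. -/
noncomputable def targetPot (k : Fin n → Fin (n + 1)) (hk : ∀ j : Fin n, j.castSucc < k j)
    (t : ℕ) (p : Fin (n + 1)) : ℝ :=
  if h : p.val < n then targetPot k hk t (k ⟨p.val, h⟩) *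
    (1 - targetEdge k hk ⟨p.val, h⟩ t / targetWeight k hk ⟨p.val, h⟩)
  else (n : ℝ) + 1 - t
termination_by n - p.val
decreasing_by
  all_goals
    have := hk ⟨p.val, h⟩
    rw [Fin.lt_def] at this
    simp only [Fin.val_castSucc] at this
    omega

section Target

variable {k : Fin n → Fin (n + 1)} (hk : ∀ j : Fin n, j.castSucc < k j)

lemma targetNode_last (t : ℕ) : targetNode k hk (Fin.last n) t = t / ((n : ℝ) + 1 - t) := by
  rw [targetNode, dif_neg (by simp)]

lemma targetNode_castSucc (c : Fin n) (t : ℕ) : targetNode k hk c.castSucc t =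
    targetEdge k hk c t * targetWeight k hk c / (targetWeight k hk c - targetEdge k hk c t) := by
  rw [targetNode, dif_pos (by simp)]
  rfl

lemma targetPot_last (t : ℕ) : targetPot k hk t (Fin.last n) = (n : ℝ) + 1 - t := by
  rw [targetPot, dif_neg (by simp)]

lemma targetPot_castSucc (c : Fin n) (t : ℕ) : targetPot k hk t c.castSucc =
    targetPot k hk t (k c) * (1 - targetEdge k hk c t / targetWeight k hk c) := by
  rw [targetPot, dif_pos (by simp)]
  rfl

lemma targetEdge_zero (c : Fin n) : targetEdge k hk c 0 = 0 := by
  simp [targetEdge]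

/-- `targetNode p` increases at the nodes below `p` and is constant at the others. -/
def TargetMono (p : Fin (n + 1)) : Prop :=
  targetNode k hk p 0 = 0 ∧ ∀ i : Fin n, i.castSucc < p →
    (Desc k i.castSucc p → targetNode k hk p i.val < targetNode k hk p (i.val + 1)) ∧
    (¬ Desc k i.castSucc p → targetNode k hk p (i.val + 1) = targetNode k hk p i.val)

open scoped Classical in
lemma targetEdge_succ (c i : Fin n) : targetEdge k hk c (i.val + 1) = targetEdge k hk c i.val +
    if Desc k i.castSucc c.castSucc then
      targetNode k hk (k c) (i.val + 1) - targetNode k hk (k c) i.val else 0 := by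
  have h : (if Desc k i.castSucc c.castSucc then
      targetNode k hk (k c) (i.val + 1) - targetNode k hk (k c) i.val else 0) =
      ∑ i' : Fin n, if i' = i then (if Desc k i'.castSucc c.castSucc then
        targetNode k hk (k c) (i'.val + 1) - targetNode k hk (k c) i'.val else 0) else 0 := by simp
  rw [h, targetEdge, targetEdge, ← sum_add_distrib]
  refine sum_congr rfl fun i' _ => ?_
  simp only [Fin.ext_iff]
  by_cases hd : Desc k i'.castSucc c.castSucc
  · simp only [hd, and_true, if_true]
    split_ifs <;> first | omega | simp
  · simp [hd]

variable {hk}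

lemma TargetMono.diff_pos {c i : Fin n} (h : TargetMono hk (k c))
    (hi : Desc k i.castSucc c.castSucc) :
    0 < targetNode k hk (k c) (i.val + 1) - targetNode k hk (k c) i.val :=
  sub_pos.2 ((h.2 i ((hi.le hk).trans_lt (hk c))).1 hi.parent)

lemma TargetMono.targetEdge_nonneg {c : Fin n} (h : TargetMono hk (k c)) (t : ℕ) :
    0 ≤ targetEdge k hk c t := by
  refine sum_nonneg fun i _ => ?_
  split_ifs with hi
  · exact (h.diff_pos hi.2).le
  · exact le_rfl

lemma TargetMono.targetEdge_lt {c : Fin n} (h : TargetMono hk (k c)) {t : ℕ} (ht : t ≤ c.val) :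
    targetEdge k hk c t < targetWeight k hk c := by
  refine sum_lt_sum (fun i _ => ?_) ⟨c, mem_univ c, ?_⟩
  · by_cases hi : Desc k i.castSucc c.castSucc
    · simp only [hi, and_true]
      have := h.diff_pos hi
      split_ifs <;> first | omega | linarith
    · simp [hi]
  · rw [if_neg (by omega), if_pos ⟨by omega, Desc.refl _⟩]
    exact h.diff_pos (Desc.refl _)

lemma targetEdge_of_lt {c : Fin n} {t : ℕ} (ht : c.val < t) :
    targetEdge k hk c t = targetWeight k hk c := by
  refine sum_congr rfl fun i _ => ?_
  by_cases hi : Desc k i.castSucc c.castSucc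
  · have h1 : i.val ≤ c.val := hi.le hk
    rw [if_pos ⟨by omega, hi⟩, if_pos ⟨by omega, hi⟩]
  · simp [hi]

lemma TargetMono.targetWeight_pos {c : Fin n} (h : TargetMono hk (k c)) :
    0 < targetWeight k hk c :=
  (h.targetEdge_nonneg 0).trans_lt (h.targetEdge_lt (Nat.zero_le _))

variable (hk)

lemma targetMono (p : Fin (n + 1)) : TargetMono hk p := by
  induction p using WellFoundedGT.induction with
  | ind p ih =>
    obtain ⟨c, rfl⟩ | rfl := p.eq_castSucc_or_eq_last
    · have h := ih _ (hk c)
      refine ⟨by rw [targetNode_castSucc, targetEdge_zero]; simp, fun i hi => ?_⟩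
      have hic : i.val < c.val := hi
      rw [targetNode_castSucc, targetNode_castSucc]
      refine ⟨fun hd => ?_, fun hd => by rw [targetEdge_succ, if_neg hd, add_zero]⟩
      have h1 : targetEdge k hk c i.val < targetEdge k hk c (i.val + 1) := by
        rw [targetEdge_succ, if_pos hd]
        have := h.diff_pos hd
        linarith
      have h2 := h.targetEdge_lt (t := i.val + 1) hic
      have h3 := h.targetWeight_pos
      rw [div_lt_div_iff₀ (by linarith) (by linarith)]
      nlinarith [mul_lt_mul_of_pos_right h1 (mul_pos h3 h3)]
    · refine ⟨by rw [targetNode_last]; simp, fun i _ => ⟨fun _ => ?_, fun h => ?_⟩⟩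
      · have hi : (i.val : ℝ) + 1 ≤ n := by exact_mod_cast i.isLt
        rw [targetNode_last, targetNode_last]
        push_cast
        rw [div_lt_div_iff₀ (by linarith) (by linarith)]
        nlinarith
      · exact absurd (desc_last hk _) h

/-- The forced conductances of the edges below `p` add up to that of `p` (parallel law). -/
lemma sum_targetEdge (p : Fin (n + 1)) {t : ℕ} (ht : t ≤ p.val) :
    ∑ c, (if k c = p then targetEdge k hk c t else 0) = targetNode k hk p t := by
  classical
  induction t with
  | zero => simp [targetEdge_zero, (targetMono hk p).1]
  | succ t ih =>
    have htn : t < n := by have := p.isLt; omega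
    set i : Fin n := ⟨t, htn⟩ with hi
    have hip : i.castSucc < p := ht
    have h1 : ∀ c, (if k c = p then targetEdge k hk c (t + 1) else 0) =
        (if k c = p then targetEdge k hk c t else 0) +
        if k c = p ∧ Desc k i.castSucc c.castSucc then
          targetNode k hk p (t + 1) - targetNode k hk p t else 0 := by
      intro c
      by_cases hc : k c = p
      · have := targetEdge_succ hk c i
        simp only [hi] at this
        simp only [hc, if_true, true_and, this]
        rfl
      · simp [hc]
    rw [sum_congr rfl fun c _ => h1 c, sum_add_distrib, ih (by omega)]
    by_cases hd : Desc k i.castSucc p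
    · obtain ⟨c, hc, huniq⟩ := existsUnique_child hk hip.ne hd
      rw [sum_eq_single c, if_pos hc]
      · ring
      · intro d _ hdc
        exact if_neg fun hd' => hdc (huniq d hd')
      · simp
    · rw [sum_eq_zero, add_zero]
      · exact (((targetMono hk p).2 i hip).2 hd).symm
      · intro c _
        refine if_neg ?_
        rintro ⟨rfl, h⟩
        exact hd h.parent

lemma targetWeight_pos (c : Fin n) : 0 < targetWeight k hk c := (targetMono hk _).targetWeight_pos

lemma targetPot_eq_zero {p : Fin (n + 1)} {t : ℕ} (hpt : p.val < t) (ht : t ≤ n + 1) :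
    targetPot k hk t p = 0 := by
  obtain ⟨c, rfl⟩ | rfl := p.eq_castSucc_or_eq_last
  · rw [targetPot_castSucc, targetEdge_of_lt (c := c) hpt, div_self (targetWeight_pos hk c).ne', sub_self,
      mul_zero]
  · rw [Fin.val_last] at hpt
    rw [targetPot_last, show t = n + 1 by omega]
    simp

lemma targetPot_zero (p : Fin (n + 1)) : targetPot k hk 0 p = (n : ℝ) + 1 := by
  induction p using WellFoundedGT.induction with
  | ind p ih =>
    obtain ⟨c, rfl⟩ | rfl := p.eq_castSucc_or_eq_last
    · rw [targetPot_castSucc, targetEdge_zero, ih _ (hk c)]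
      simp
    · simp [targetPot_last]

lemma targetFlow (c : Fin n) (t : ℕ) :
    targetWeight k hk c * (targetPot k hk t (k c) - targetPot k hk t c.castSucc) =
      targetEdge k hk c t * targetPot k hk t (k c) := by
  have := (targetWeight_pos hk c).ne'
  rw [targetPot_castSucc]
  field_simp
  ring

lemma inflow_target (p : Fin (n + 1)) {t : ℕ} (ht : t ≤ p.val) :
    inflow k (targetWeight k hk) (targetPot k hk t) p =
      targetNode k hk p t * targetPot k hk t p := by
  rw [← sum_targetEdge hk p ht, inflow, sum_mul]
  refine sum_congr rfl fun c _ => ?_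
  split_ifs with h
  · rw [← h, targetFlow]
  · rw [zero_mul]

/-- The potential is harmonic at the nodes that are not grounded, with a source at the root. -/
lemma treeLap_mulVec_targetPot (p : Fin (n + 1)) {t : ℕ} (ht : t ≤ p.val) :
    (treeLap k (targetWeight k hk) *ᵥ targetPot k hk t) p =
      if p = Fin.last n then (n : ℝ) + 1 else 0 := by
  obtain ⟨c, rfl⟩ | rfl := p.eq_castSucc_or_eq_last
  · rw [if_neg (Fin.castSucc_lt_last c).ne, treeLap_mulVec_castSucc, inflow_target hk _ ht,
      targetFlow, targetNode_castSucc, targetPot_castSucc]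
    have h1 := (targetWeight_pos hk c).ne'
    have h2 := (targetMono hk (k c)).targetEdge_lt (c := c) (t := t) ht
    have h3 : targetWeight k hk c - targetEdge k hk c t ≠ 0 := by linarith
    field_simp
    ring
  · rw [if_pos rfl, treeLap_mulVec_last, inflow_target hk _ ht, targetNode_last, targetPot_last]
    have h1 : (t : ℝ) ≤ n := by exact_mod_cast ht
    have h2 : (n : ℝ) + 1 - t ≠ 0 := by linarith
    field_simp
    ring

end Target

/-! ### Uniqueness of optimal algorithms with a given sparsity pattern -/

section Unique

variable {k : Fin n → Fin (n + 1)} {H : Matrix (Fin n) (Fin n) ℝ}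

/-- If the certificate of each `j` vanishes except at one node `k j`, the Gram matrix of the factor
is `N` times the weighted Laplacian of a tree. -/
lemma gram_eq_treeLap (hk : ∀ j : Fin n, j.castSucc < k j) (hH : H ∈ optimalMatrices n)
    (hpat : ∀ (j : Fin n) (l : Fin (n + 1)), j.castSucc < l → l ≠ k j → cert H l j = 0) :
    (factor (cumul H))ᵀ * factor (cumul H) =
      ((n : ℝ) + 1) • treeLap k fun j => cert H (k j) j := by
  have hB : ∀ a b, a ≤ b → cumul H a b = 0 := fun a b => cumul_eq_zero H
  have hN : (n : ℝ) + 1 ≠ 0 := by positivity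
  have key : ((n : ℝ) + 1)⁻¹ • ((factor (cumul H))ᵀ * factor (cumul H)) =
      treeLap k fun j => cert H (k j) j := by
    refine eq_treeLap hk (fun a b => ?_) (fun a => ?_) fun a j haj => ?_
    · simp only [Matrix.smul_apply, Matrix.mul_apply, transpose_apply]
      congr 1
      exact sum_congr rfl fun r _ => mul_comm _ _
    · simp only [Matrix.smul_apply, Matrix.mul_apply, transpose_apply, smul_eq_mul, ← mul_sum]
      rw [sum_comm]
      simp only [← mul_sum, sum_factor_row_of_optimal hH, mul_one, sum_factor hB]
      split_ifs
      · exact inv_mul_cancel₀ hN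
      · exact mul_zero _
    · simp only [Matrix.smul_apply, Matrix.mul_apply, transpose_apply, smul_eq_mul]
      rw [← neg_neg (∑ r, _), ← cert_eq H a j haj, mul_neg, inv_mul_cancel_left₀ hN]
      split_ifs with h
      · rw [h]
      · rw [hpat j a haj (Ne.symm h), neg_zero]
  rw [← key, smul_inv_smul₀ hN]

/-- The energy of the indicator of the subtree below `j` is the certificate, and the Gram matrix is
positive definite. -/
lemma cert_pos (hk : ∀ j : Fin n, j.castSucc < k j) (hH : H ∈ optimalMatrices n)
    (hpat : ∀ (j : Fin n) (l : Fin (n + 1)), j.castSucc < l → l ≠ k j → cert H l j = 0)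
    (j : Fin n) : 0 < cert H (k j) j := by
  classical
  have hB : ∀ a b, a ≤ b → cumul H a b = 0 := fun a b => cumul_eq_zero H
  have hN : (0 : ℝ) < (n : ℝ) + 1 := by positivity
  have hE := energy_subtree hk (fun j => cert H (k j) j) j
  set x : Fin (n + 1) → ℝ := fun a => if Desc k a j.castSucc then 1 else 0 with hx
  set U := factor (cumul H) with hU
  have hdet : IsUnit U.det := (lowerTriangular_inv (fun r j => factor_eq_zero hB)
    (factor_diag_ne_zero hB (sum_factor_row_of_optimal hH))).1
  have h1 : (U *ᵥ x) ⬝ᵥ (U *ᵥ x) = ((n : ℝ) + 1) * cert H (k j) j := by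
    rw [← hE, ← smul_eq_mul, ← dotProduct_smul, ← smul_mulVec, ← gram_eq_treeLap hk hH hpat,
      ← mulVec_mulVec, ← hU, dotProduct_mulVec x, vecMul_transpose]
  have h2 : 0 < (U *ᵥ x) ⬝ᵥ (U *ᵥ x) := by
    refine lt_of_le_of_ne (sum_nonneg fun a _ => mul_self_nonneg _) fun h => ?_
    have h3 := eq_zero_of_mulVec_eq_zero hdet.ne_zero (dotProduct_self_eq_zero.1 h.symm)
    have h4 := congrFun h3 j.castSucc
    simp [hx, Desc.refl] at h4
  rw [h1] at h2
  exact pos_of_mul_pos_right h2 hN.le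

/-- The columns of `N • (factor B)⁻¹`, summed over the indices from `t` on, are the potentials of the
tree with `0, …, t - 1` grounded. They prescribe the conductance `t / (N - t)` at the root. -/
lemma nodeCond_cert (hk : ∀ j : Fin n, j.castSucc < k j) (hH : H ∈ optimalMatrices n)
    (hpat : ∀ (j : Fin n) (l : Fin (n + 1)), j.castSucc < l → l ≠ k j → cert H l j = 0)
    {t : ℕ} (ht : t ≤ n) :
    nodeCond k hk (fun j => cert H (k j) j) t (Fin.last n) = t / ((n : ℝ) + 1 - t) := by
  have hB : ∀ a b, a ≤ b → cumul H a b = 0 := fun a b => cumul_eq_zero H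
  have hN : (0 : ℝ) < (n : ℝ) + 1 := by positivity
  have hgram := gram_eq_treeLap hk hH hpat
  obtain ⟨hdet, hinv⟩ := lowerTriangular_inv (fun r j => factor_eq_zero hB)
    (factor_diag_ne_zero hB (sum_factor_row_of_optimal hH))
  set U := factor (cumul H) with hU
  have hcol : ∀ a, ∑ r, U r a = if a = Fin.last n then (n : ℝ) + 1 else 0 := sum_factor hB
  have hlast : ∀ i, ((n : ℝ) + 1) * U⁻¹ (Fin.last n) i = 1 := by
    intro i
    have h1 : ∑ r, (U * U⁻¹) r i = 1 := by
      rw [mul_nonsing_inv _ hdet]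
      simp [one_apply]
    simp only [Matrix.mul_apply] at h1
    rw [sum_comm] at h1
    simpa only [← sum_mul, hcol, ite_mul, zero_mul, sum_ite_eq', mem_univ, if_true] using h1
  set s : Fin (n + 1) → ℝ := fun i => if t ≤ i.val then 1 else 0 with hs
  set v : Fin (n + 1) → ℝ := ((n : ℝ) + 1) • (U⁻¹ *ᵥ s) with hv
  have hvlast : v (Fin.last n) = (n : ℝ) + 1 - t := by
    have h1 : v (Fin.last n) = ∑ i, s i := by
      rw [hv, Pi.smul_apply, mulVec, dotProduct, smul_eq_mul, mul_sum]
      exact sum_congr rfl fun i _ => by rw [← mul_assoc, hlast, one_mul]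
    have h2 : ∑ i, s i = ∑ i ∈ range (n + 1), if t ≤ i then (1 : ℝ) else 0 :=
      Fin.sum_univ_eq_sum_range (fun i => if t ≤ i then (1 : ℝ) else 0) (n + 1)
    have h3 : (range (n + 1)).filter (fun i => t ≤ i) = Ico t (n + 1) := by
      ext i
      simp only [mem_filter, mem_range, mem_Ico]
      omega
    rw [h1, h2, sum_boole, h3, Nat.card_Ico, Nat.cast_sub (by omega)]
    push_cast
    ring
  have hground : ∀ c : Fin n, c.val < t → v c.castSucc = 0 := by
    intro c hc
    rw [hv, Pi.smul_apply, mulVec, dotProduct, sum_eq_zero, smul_zero]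
    intro i _
    rcases lt_or_ge c.castSucc i with h | h
    · rw [hinv _ _ h, zero_mul]
    · have : ¬ t ≤ i.val := by
        rw [Fin.le_def, Fin.val_castSucc] at h
        omega
      simp [hs, this]
  have hlap : ∀ a : Fin (n + 1), t ≤ a.val → (treeLap k (fun j => cert H (k j) j) *ᵥ v) a =
      if a = Fin.last n then (n : ℝ) + 1 else 0 := by
    intro a ha
    rw [hv, mulVec_smul, ← smul_mulVec, ← hgram, mulVec_mulVec, mul_nonsing_inv_cancel_right _ _ hdet,
      ← hcol, mulVec, dotProduct]
    refine sum_congr rfl fun i _ => ?_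
    rw [transpose_apply]
    rcases lt_or_ge i.val t with h | h
    · rw [hU, factor_eq_zero hB (Fin.lt_def.2 (h.trans_le ha)), zero_mul]
    · simp [hs, h]
  have h := nodeCond_last_mul (hk := hk) (cert_pos hk hH hpat) hground fun c hc => by
    rw [hlap _ hc, if_neg (Fin.castSucc_lt_last c).ne]
  rw [hlap _ ht, if_pos rfl, hvlast] at h
  have h1 : (t : ℝ) ≤ n := by exact_mod_cast ht
  rw [eq_div_iff (by linarith)]
  linarith

lemma eq_of_pattern {H' : Matrix (Fin n) (Fin n) ℝ} (hk : ∀ j : Fin n, j.castSucc < k j)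
    (hH : H ∈ optimalMatrices n) (hH' : H' ∈ optimalMatrices n)
    (hpat : ∀ (j : Fin n) (l : Fin (n + 1)), j.castSucc < l → l ≠ k j → cert H l j = 0)
    (hpat' : ∀ (j : Fin n) (l : Fin (n + 1)), j.castSucc < l → l ≠ k j → cert H' l j = 0) :
    H = H' := by
  have hw := eq_of_nodeCond_last_eq (hk := hk) (cert_pos hk hH hpat) (cert_pos hk hH' hpat')
    fun t ht => by rw [nodeCond_cert hk hH hpat ht, nodeCond_cert hk hH' hpat' ht]
  refine eq_of_cumul_eq hH.1 hH'.1 (eq_of_gram_eq (fun a b => cumul_eq_zero H)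
    (fun a b => cumul_eq_zero H')
    (factor_diag_ne_zero (fun a b => cumul_eq_zero H) (sum_factor_row_of_optimal hH)) ?_)
  rw [gram_eq_treeLap hk hH hpat, gram_eq_treeLap hk hH' hpat', hw]

end Unique

/-! ### Existence of optimal algorithms with a given sparsity pattern -/

/-- The inverse of the factor is the matrix of the successive differences of the potentials
`targetPot`. -/
lemma exists_factor {k : Fin n → Fin (n + 1)} (hk : ∀ j : Fin n, j.castSucc < k j) :
    ∃ U F : Matrix (Fin (n + 1)) (Fin (n + 1)) ℝ, U * F = 1 ∧
      (∀ r j, r < j → U r j = 0) ∧ (∀ r j, r < j → F r j = 0) ∧ (∀ r, ∑ j, U r j = 1) ∧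
      (∀ j, ∑ r, U r j = if j = Fin.last n then (n : ℝ) + 1 else 0) ∧
      Uᵀ * U = ((n : ℝ) + 1) • treeLap k (targetWeight k hk) := by
  have hN : (n : ℝ) + 1 ≠ 0 := by positivity
  set v : ℕ → Fin (n + 1) → ℝ := targetPot k hk with hv
  set S := treeLap k (targetWeight k hk) with hS
  have hlap : ∀ (a : Fin (n + 1)) (t : ℕ), t ≤ a.val → (S *ᵥ v t) a =
      if a = Fin.last n then (n : ℝ) + 1 else 0 := fun a t => treeLap_mulVec_targetPot hk a
  have hground : ∀ (a : Fin (n + 1)) (t : ℕ), a.val < t → t ≤ n + 1 → v t a = 0 :=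
    fun a t => targetPot_eq_zero hk
  have hend : v (n + 1) = 0 := funext fun a => hground a _ a.isLt le_rfl
  have hSt : Sᵀ = S := by
    ext a b
    exact treeLap_symm k _ b a
  set F : Matrix (Fin (n + 1)) (Fin (n + 1)) ℝ :=
    of fun a i => (v i.val a - v (i.val + 1) a) / ((n : ℝ) + 1) with hF
  set U : Matrix (Fin (n + 1)) (Fin (n + 1)) ℝ := (((n : ℝ) + 1) • (S * F))ᵀ with hU
  have hUapply : ∀ i a, U i a = (S *ᵥ v i.val) a - (S *ᵥ v (i.val + 1)) a := by
    intro i a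
    simp only [hU, hF, transpose_apply, Matrix.smul_apply, Matrix.mul_apply, of_apply, mulVec,
      dotProduct, smul_eq_mul, mul_sum, ← sum_sub_distrib]
    refine sum_congr rfl fun b _ => ?_
    field_simp
  have hUlow : ∀ i a, i < a → U i a = 0 := by
    intro i a h
    rw [Fin.lt_def] at h
    rw [hUapply, hlap a _ h.le, hlap a _ h, sub_self]
  have hFlow : ∀ a i, a < i → F a i = 0 := by
    intro a i h
    rw [Fin.lt_def] at h
    rw [hF, of_apply, hground a _ h (by omega), hground a _ (by omega) (by omega)]
    simp
  have hFsum : F *ᵥ (fun _ => 1) = fun _ => 1 := by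
    funext a
    simp only [mulVec, dotProduct, hF, of_apply, mul_one, ← sum_div]
    rw [Fin.sum_univ_eq_sum_range (fun i => v i a - v (i + 1) a), sum_range_sub', hend]
    simp only [hv, targetPot_zero, Pi.zero_apply, sub_zero]
    exact div_self hN
  have hUcol : ∀ a, ∑ r, U r a = if a = Fin.last n then (n : ℝ) + 1 else 0 := by
    intro a
    simp only [hUapply]
    rw [Fin.sum_univ_eq_sum_range (fun i => (S *ᵥ v i) a - (S *ᵥ v (i + 1)) a),
      sum_range_sub' (fun i => (S *ᵥ v i) a), hend, hlap a 0 (Nat.zero_le _)]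
    simp
  have hFlast : ∀ i, ((n : ℝ) + 1) * F (Fin.last n) i = 1 := by
    intro i
    simp only [hF, of_apply, hv, targetPot_last]
    push_cast
    field_simp
    ring
  have hUF : U * F = 1 := by
    -- `U * F` is lower triangular and symmetric, hence diagonal, and it has column sums one
    have hsymm : (U * F)ᵀ = U * F := by
      rw [transpose_mul, hU, transpose_transpose, transpose_smul, transpose_mul, hSt,
        Matrix.mul_smul, Matrix.smul_mul, Matrix.mul_assoc]
    have hlow : ∀ a b, a < b → (U * F) a b = 0 := by
      intro a b hab
      rw [Matrix.mul_apply]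
      refine sum_eq_zero fun c _ => ?_
      rcases lt_or_ge c b with h | h
      · rw [hFlow c b h, mul_zero]
      · rw [hUlow a c (hab.trans_le h), zero_mul]
    have hoff : ∀ a b, a ≠ b → (U * F) a b = 0 := by
      intro a b hab
      rcases lt_or_gt_of_ne hab with h | h
      · exact hlow a b h
      · rw [← hsymm, transpose_apply, hlow b a h]
    ext a b
    rcases eq_or_ne a b with rfl | hab
    · have h1 : ∑ r, (U * F) r a = 1 := by
        simp only [Matrix.mul_apply]
        rw [sum_comm]
        simp only [← sum_mul, hUcol, ite_mul, zero_mul, sum_ite_eq', mem_univ, if_true, hFlast]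
      rw [sum_eq_single a (fun r _ hr => hoff r a hr) (by simp)] at h1
      rw [h1, one_apply_eq]
    · rw [hoff a b hab, one_apply_ne hab]
  refine ⟨U, F, hUF, hUlow, hFlow, fun r => ?_, hUcol, ?_⟩
  · have h1 : (U *ᵥ fun _ => (1 : ℝ)) r = 1 := by
      rw [← hFsum, mulVec_mulVec, hUF, one_mulVec]
    simpa [mulVec, dotProduct] using h1
  · have hUt : Uᵀ = ((n : ℝ) + 1) • (S * F) := by rw [hU, transpose_transpose]
    rw [hUt, Matrix.smul_mul, Matrix.mul_assoc, mul_eq_one_comm.1 hUF, Matrix.mul_one]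

lemma exists_optimal_pattern {k : Fin n → Fin (n + 1)} (hk : ∀ j : Fin n, j.castSucc < k j) :
    ∃ H ∈ optimalMatrices n, HasSparsityPattern H k := by
  obtain ⟨U, F, hUF, hUlow, hFlow, hrow, hcol, hgram⟩ := exists_factor hk
  have hB : ∀ a b, a ≤ b → (F * belowDiag n * U) a b = 0 := by
    intro a b hab
    refine mul_lower_apply_eq_zero' (fun a b hab => ?_) hUlow hab
    exact mul_lower_apply_eq_zero hFlow (fun a b hab => if_neg hab.not_gt) hab
  obtain ⟨H, hlow, hcum⟩ := exists_cumul_eq hB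
  have hU : U = factor (cumul H) := by
    rw [hcum]
    refine eq_factor_of_mul hB ?_ hcol
    rw [← Matrix.mul_assoc, ← Matrix.mul_assoc, hUF, Matrix.one_mul]
  have hN : (n : ℝ) + 1 ≠ 0 := by positivity
  have hcert : ∀ (a : Fin (n + 1)) (j : Fin n), j.castSucc < a →
      cert H a j = if k j = a then targetWeight k hk j else 0 := by
    intro a j haj
    have h1 := cert_eq H a j haj
    have h2 := congrFun (congrFun hgram a) j.castSucc
    rw [Matrix.smul_apply, treeLap_apply_of_lt hk _ haj, Matrix.mul_apply, smul_eq_mul] at h2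
    simp only [transpose_apply] at h2
    rw [← hU, h2] at h1
    have h3 := mul_left_cancel₀ hN (h1.trans (mul_neg _ _).symm)
    rw [h3]
    split_ifs <;> simp
  refine ⟨H, mem_optimalMatrices hlow (by rwa [← hU]) fun a j haj => ?_, fun j => ⟨?_, ?_⟩⟩
  · rw [hcert a j haj]
    split_ifs
    · exact (targetWeight_pos hk j).le
    · exact le_rfl
  · rw [hcert _ j (hk j), if_pos rfl]
    exact targetWeight_pos hk j
  · intro l hl hlk
    rw [hcert l j hl, if_neg (Ne.symm hlk)]

/-! ### Vertices and arc diagrams -/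

/-- The pairs of nodes with nonvanishing certificate. -/
def certSupport (H : Matrix (Fin n) (Fin n) ℝ) : Set (Fin (n + 1) × Fin n) :=
  {p | p.2.castSucc < p.1 ∧ cert H p.1 p.2 ≠ 0}

lemma zeroCount_add_ncard_certSupport (H : Matrix (Fin n) (Fin n) ℝ) :
    zeroCount H + (certSupport H).ncard =
      {p : Fin (n + 1) × Fin n | p.2.castSucc < p.1}.ncard := by
  rw [zeroCount, ← Set.ncard_union_eq]
  · congr 1
    ext p
    simp only [certSupport, Set.mem_union, Set.mem_ofPred_eq]
    tauto
  · rw [Set.disjoint_left]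
    rintro p ⟨-, h⟩ ⟨-, h'⟩
    exact h' h

lemma ncard_range_parent (k : Fin n → Fin (n + 1)) :
    (Set.range fun j => (k j, j)).ncard = n := by
  rw [← Set.image_univ, Set.ncard_image_of_injective _ fun i j h => (Prod.ext_iff.1 h).2]
  simp

lemma HasSparsityPattern.certSupport_eq {H : Matrix (Fin n) (Fin n) ℝ} {k : Fin n → Fin (n + 1)}
    (hk : ∀ j : Fin n, j.castSucc < k j) (h : HasSparsityPattern H k) :
    certSupport H = Set.range fun j => (k j, j) := by
  ext ⟨a, j⟩
  simp only [certSupport, Set.mem_ofPred_eq, Set.mem_range, Prod.mk.injEq]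
  constructor
  · rintro ⟨h1, h2⟩
    refine ⟨j, ?_, rfl⟩
    by_contra hne
    exact h2 ((h j).2 a h1 (Ne.symm hne))
  · rintro ⟨j, rfl, rfl⟩
    exact ⟨hk j, (h j).1.ne'⟩

lemma exists_parent_range_subset {H : Matrix (Fin n) (Fin n) ℝ} (hH : H ∈ optimalMatrices n) :
    ∃ k : Fin n → Fin (n + 1), (∀ j : Fin n, j.castSucc < k j) ∧
      (Set.range fun j => (k j, j)) ⊆ certSupport H := by
  choose k hk hk' using exists_cert_ne_zero hH
  refine ⟨k, hk, ?_⟩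
  rintro _ ⟨j, rfl⟩
  exact ⟨hk j, hk' j⟩

lemma HasSparsityPattern.mem_vertices {H : Matrix (Fin n) (Fin n) ℝ} {k : Fin n → Fin (n + 1)}
    (hk : ∀ j : Fin n, j.castSucc < k j) (hH : H ∈ optimalMatrices n)
    (h : HasSparsityPattern H k) : H ∈ vertices n := by
  refine ⟨hH, fun H' hH' => ?_⟩
  obtain ⟨k', -, hsub⟩ := exists_parent_range_subset hH'
  have h1 := Set.ncard_le_ncard hsub
  have h2 := zeroCount_add_ncard_certSupport H
  have h3 := zeroCount_add_ncard_certSupport H'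
  rw [h.certSupport_eq hk, ncard_range_parent] at h2
  rw [ncard_range_parent] at h1
  omega

lemma exists_pattern_of_mem_vertices {H : Matrix (Fin n) (Fin n) ℝ} (h : H ∈ vertices n) :
    ∃ k : Fin n → Fin (n + 1), (∀ j : Fin n, j.castSucc < k j) ∧ HasSparsityPattern H k := by
  obtain ⟨hH, hmax⟩ := h
  obtain ⟨k, hk, hsub⟩ := exists_parent_range_subset hH
  obtain ⟨H', hH', hpat'⟩ := exists_optimal_pattern hk
  have h1 := hmax H' hH'
  have h2 := zeroCount_add_ncard_certSupport H
  have h3 := zeroCount_add_ncard_certSupport H'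
  rw [hpat'.certSupport_eq hk, ncard_range_parent] at h3
  have heq := Set.eq_of_subset_of_ncard_le hsub (by rw [ncard_range_parent]; omega)
  have hpat : ∀ (j : Fin n) (l : Fin (n + 1)), j.castSucc < l → l ≠ k j → cert H l j = 0 := by
    intro j l hl hlk
    by_contra hne
    have hmem : (l, j) ∈ certSupport H := ⟨hl, hne⟩
    rw [← heq] at hmem
    obtain ⟨i, hi⟩ := hmem
    rw [Prod.mk.injEq] at hi
    obtain ⟨rfl, rfl⟩ := hi
    exact hlk rfl
  exact ⟨k, hk, fun j => ⟨cert_pos hk hH hpat j, hpat j⟩⟩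

lemma diagram_adj_iff {H : Matrix (Fin n) (Fin n) ℝ} {j : Fin n} {l : Fin (n + 1)}
    (h : j.castSucc < l) : (diagram H).Adj j.castSucc l ↔ cert H l j ≠ 0 := by
  rw [diagram, SimpleGraph.fromRel_adj]
  constructor
  · rintro ⟨-, ⟨_, rfl, h1, -⟩ | ⟨i, hi, -, h2⟩⟩
    · exact absurd h1 h.not_gt
    · rwa [Fin.castSucc_injective _ hi]
  · exact fun h1 => ⟨h.ne, Or.inr ⟨j, rfl, h, h1⟩⟩

lemma HasSparsityPattern.diagram_adj_iff {H : Matrix (Fin n) (Fin n) ℝ} {k : Fin n → Fin (n + 1)}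
    (hpat : HasSparsityPattern H k) {j : Fin n} {l : Fin (n + 1)} (h : j.castSucc < l) :
    (diagram H).Adj j.castSucc l ↔ l = k j := by
  rw [FixedPointAlg.diagram_adj_iff h]
  constructor
  · intro h1
    by_contra hne
    exact h1 ((hpat j).2 l h hne)
  · rintro rfl
    exact (hpat j).1.ne'

lemma HasSparsityPattern.isArcDiagram {H : Matrix (Fin n) (Fin n) ℝ} {k : Fin n → Fin (n + 1)}
    (hk : ∀ j : Fin n, j.castSucc < k j) (hpat : HasSparsityPattern H k) :
    IsArcDiagram (diagram H) := fun j =>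
  ⟨k j, ⟨hk j, (hpat.diagram_adj_iff (hk j)).2 rfl⟩, fun _ hl => (hpat.diagram_adj_iff hl.1).1 hl.2⟩

/-- A graph on the nodes is determined by the adjacencies of each node to larger ones. -/
lemma graph_ext {G G' : SimpleGraph (Fin (n + 1))}
    (h : ∀ (j : Fin n) (l : Fin (n + 1)), j.castSucc < l →
      (G.Adj j.castSucc l ↔ G'.Adj j.castSucc l)) : G = G' := by
  have hlt : ∀ a b : Fin (n + 1), a < b → (G.Adj a b ↔ G'.Adj a b) := by
    intro a b hab
    obtain ⟨j, rfl⟩ | rfl := a.eq_castSucc_or_eq_last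
    · exact h j b hab
    · exact absurd hab (Fin.le_last b).not_gt
  ext a b
  rcases lt_trichotomy a b with hab | rfl | hab
  · exact hlt a b hab
  · simp
  · rw [G.adj_comm, G'.adj_comm, hlt b a hab]

lemma bijOn_diagram : Set.BijOn diagram (vertices n)
    {G : SimpleGraph (Fin (n + 1)) | IsArcDiagram G} := by
  refine ⟨fun H hH => ?_, fun H hH H' hH' heq => ?_, fun G hG => ?_⟩
  · obtain ⟨k, hk, hpat⟩ := exists_pattern_of_mem_vertices hH
    exact hpat.isArcDiagram hk
  · obtain ⟨k, hk, hpat⟩ := exists_pattern_of_mem_vertices hH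
    obtain ⟨k', hk', hpat'⟩ := exists_pattern_of_mem_vertices hH'
    have hkk : k = k' := by
      funext j
      rw [← hpat'.diagram_adj_iff (hk j), ← heq]
      exact (hpat.diagram_adj_iff (hk j)).2 rfl
    subst hkk
    exact eq_of_pattern hk hH.1 hH'.1 (fun j => (hpat j).2) fun j => (hpat' j).2
  · choose k hk huniq using hG
    obtain ⟨H, hH, hpat⟩ := exists_optimal_pattern fun j => (hk j).1
    refine ⟨H, hpat.mem_vertices (fun j => (hk j).1) hH, graph_ext fun j l hl => ?_⟩
    rw [hpat.diagram_adj_iff hl]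
    constructor
    · rintro rfl
      exact (hk j).2
    · exact fun h => huniq j l ⟨hl, h⟩

lemma ncard_parentFunctions (n : ℕ) :
    {k : Fin n → Fin (n + 1) | ∀ j : Fin n, j.castSucc < k j}.ncard = n.factorial := by
  have h : {k : Fin n → Fin (n + 1) | ∀ j : Fin n, j.castSucc < k j} =
      (Fintype.piFinset fun j : Fin n => Ioi j.castSucc : Finset (Fin n → Fin (n + 1))) := by
    ext k
    simp
  rw [h, Set.ncard_coe_finset, Fintype.card_piFinset]
  simp only [Fin.card_Ioi, Fin.val_castSucc]
  rw [Fin.prod_univ_eq_prod_range (fun j => n + 1 - 1 - j), ← Nat.descFactorial_self,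
    Nat.descFactorial_eq_prod_range]
  simp

lemma ncard_vertices (n : ℕ) : (vertices n).ncard = n.factorial := by
  have hex : ∀ k : Fin n → Fin (n + 1), ∃ H, (∀ j : Fin n, j.castSucc < k j) →
      H ∈ optimalMatrices n ∧ HasSparsityPattern H k := by
    intro k
    by_cases hk : ∀ j : Fin n, j.castSucc < k j
    · obtain ⟨H, hH, hpat⟩ := exists_optimal_pattern hk
      exact ⟨H, fun _ => ⟨hH, hpat⟩⟩
    · exact ⟨0, fun h => absurd h hk⟩
  choose f hf using hex
  have himage : vertices n = f '' {k | ∀ j : Fin n, j.castSucc < k j} := by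
    ext H
    constructor
    · intro hH
      obtain ⟨k, hk, hpat⟩ := exists_pattern_of_mem_vertices hH
      exact ⟨k, hk, eq_of_pattern hk (hf k hk).1 hH.1 (fun j => ((hf k hk).2 j).2)
        fun j => (hpat j).2⟩
    · rintro ⟨k, hk, rfl⟩
      exact (hf k hk).2.mem_vertices hk (hf k hk).1
  rw [himage, Set.InjOn.ncard_image, ncard_parentFunctions]
  intro k hk k' hk' heq
  funext j
  rw [← (hf k' hk').2.diagram_adj_iff (hk j), ← heq]
  exact ((hf k hk).2.diagram_adj_iff (hk j)).2 rfl

lemma IsArcDiagram.isTree {G : SimpleGraph (Fin (n + 1))} (hG : IsArcDiagram G) : G.IsTree := by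
  choose k hk huniq using hG
  rw [SimpleGraph.isTree_iff_connected_and_card]
  constructor
  · have hreach : ∀ a, G.Reachable a (Fin.last n) := by
      intro a
      induction a using WellFoundedGT.induction with
      | ind a ih =>
        obtain ⟨j, rfl⟩ | rfl := a.eq_castSucc_or_eq_last
        · exact (hk j).2.reachable.trans (ih _ (hk j).1)
        · exact SimpleGraph.Reachable.refl _
    exact ⟨fun a b => (hreach a).trans (hreach b).symm⟩
  · have hrange : G.edgeSet = Set.range fun j => s(j.castSucc, k j) := by
      ext e
      induction e using Sym2.ind with
      | _ a b =>
        rw [SimpleGraph.mem_edgeSet, Set.mem_range]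
        have key : ∀ a b : Fin (n + 1), a < b → G.Adj a b → ∃ j, s(j.castSucc, k j) = s(a, b) := by
          intro a b hab h
          obtain ⟨j, rfl⟩ | rfl := a.eq_castSucc_or_eq_last
          · exact ⟨j, by rw [huniq j b ⟨hab, h⟩]⟩
          · exact absurd hab (Fin.le_last b).not_gt
        constructor
        · intro h
          rcases lt_or_gt_of_ne h.ne with hab | hab
          · exact key a b hab h
          · rw [Sym2.eq_swap]
            exact key b a hab h.symm
        · rintro ⟨j, hj⟩
          rw [← SimpleGraph.mem_edgeSet, ← hj, SimpleGraph.mem_edgeSet]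
          exact (hk j).2
    have hinj : Function.Injective fun j => s(j.castSucc, k j) := by
      intro i j hij
      rcases Sym2.eq_iff.1 hij with ⟨h, -⟩ | ⟨h1, h2⟩
      · exact Fin.castSucc_injective _ h
      · have h3 := (hk i).1
        rw [h2, h1] at h3
        exact absurd h3 (hk j).1.not_gt
    rw [hrange, Nat.card_range_of_injective hinj, Nat.card_fin, Nat.card_fin]

end FixedPointAlg

theorem mainTheorem1 (n : ℕ) :
    (∀ k : Fin n → Fin (n + 1), (∀ j : Fin n, j.castSucc < k j) →
      (∃! H : Matrix (Fin n) (Fin n) ℝ,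
        H ∈ FixedPointAlg.optimalMatrices n ∧ FixedPointAlg.HasSparsityPattern H k) ∧
      (∀ H ∈ FixedPointAlg.optimalMatrices n,
        FixedPointAlg.HasSparsityPattern H k → H ∈ FixedPointAlg.vertices n)) ∧
    (FixedPointAlg.vertices n).ncard = n.factorial ∧
    Set.BijOn FixedPointAlg.diagram (FixedPointAlg.vertices n)
      {G : SimpleGraph (Fin (n + 1)) | FixedPointAlg.IsArcDiagram G} ∧
    (∀ G : SimpleGraph (Fin (n + 1)), FixedPointAlg.IsArcDiagram G → G.IsTree) := by
  refine ⟨fun k hk => ⟨?_, fun H hH hpat => hpat.mem_vertices hk hH⟩,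
    FixedPointAlg.ncard_vertices n, FixedPointAlg.bijOn_diagram, fun G hG => hG.isTree⟩
  obtain ⟨H, hH, hpat⟩ := FixedPointAlg.exists_optimal_pattern hk
  exact ⟨H, ⟨hH, hpat⟩, fun H' h' => FixedPointAlg.eq_of_pattern hk h'.1 hH
    (fun j => (h'.2 j).2) fun j => (hpat j).2⟩
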